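/- Let $\tau$ be an indeterminate over $\mathbb{Q}$ and let $$\mathbb{F}_{\ge 0}=\{f/g : f,g\in\mathbb{Z}_{\ge0}[\tau],\ g\neq 0\}\subset\mathbb{Q}(\tau).$$ Let $\mathcal{P}_2$ be the set of integer partitions $\lambda=(\lambda_1\ge\lambda_2\ge 0)$ of length at most $2$, and write $\lambda\succcurlyeq\mu$ if $\lambda_1\ge\mu_1$ and $\lambda_1+\lambda_2=\mu_1+\mu_2$. Let $m_\lambda(x)$ be the monomial symmetric polynomials, $M_\lambda=m_\lambda/m_\lambda(1,1)$, and let $s_\nu(x)=\det(x_i^{\nu_j+2-j})_{1\le i,j\le 2}/(x_1-x_2)$ be the Schur polynomials in $x=(x_1,x_2)$. Let $P_\lambda(x;\tau)$ be the Jack polynomial in $x=(x_1,x_2)$ with parameter $\tau=1/\alpha$, monic in $m_\lambda$: it is the restriction to two variables of the Jack symmetric function $P_\lambda(\tau)$. The Jack symmetric functions form the family in the ring of symmetric functions over $\mathbb{Q}(\tau)$ such that $P_\lambda(\tau)$ is $m_\lambda$ plus a combination of the $m_\mu$ with $\mu$ strictly below $\lambda$ in the dominance order, and which is pairwise orthogonal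 for the scalar product $\langle p_\lambda,p_\mu\rangle_\tau=\delta_{\lambda\mu}z_\lambda\tau^{-\ell(\lambda)}$ on power sums. Then for all $\lambda,\mu\in\mathcal{P}_2$ with $\lambda\succcurlyeq\mu$, $$\frac{1}{(x_1-x_2)^2}\left(\frac{P_\lambda(x;\tau)}{P_\lambda(1,1;\tau)}-\frac{P_\mu(x;\tau)}{P_\mu(1,1;\tau)}\right)\in\bigoplus_{\nu\in\mathcal{P}_2}\mathbb{F}_{\ge0}\cdot s_\nu(x),$$ that is, the left-hand side can be written, in a unique way, as a finite sum $\sum_\nu c_\nu s_\nu(x)$ with all $c_\nu\in\mathbb{F}_{\ge0}$. Moreover, for all integers $a\ge 0$ and $b\ge 1$, $$\frac{2}{(x_1-x_2)^2}\left(M_{(a+b+1,a)}(x)-M_{(a+b,a+1)}(x)\right)=s_{(a+b-1,a)}(x).$$ -/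

import Mathlib

open Finset MvPolynomial

noncomputable section

namespace JackPoly

/-- The field `ℚ(τ)` of rational functions in the indeterminate `τ`. -/
abbrev F : Type := RatFunc ℚ

/-- The indeterminate `τ` of `ℚ(τ)`. -/
def tau : F := RatFunc.X

/-- The cone of positivity `{f / g : f, g ∈ ℤ_{≥0}[τ], g ≠ 0}` in `ℚ(τ)`. -/
def posCone : Set F :=
  {r | ∃ f g : Polynomial ℕ, g ≠ 0 ∧
    r = algebraMap (Polynomial ℚ) F (f.map (Nat.castRingHom ℚ)) /
        algebraMap (Polynomial ℚ) F (g.map (Nat.castRingHom ℚ))}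

/-! ### Partitions -/

/-- `P n`: integer partitions of length at most `n`, that is, `n`-tuples
`lam 0 ≥ lam 1 ≥ ⋯ ≥ lam (n - 1) ≥ 0` of integers. -/
abbrev P (n : ℕ) : Type := {lam : Fin n → ℕ // Antitone lam}

/-- Majorization of `n`-tuples (the dominance order): every initial partial sum of `a` is at least
that of `b`, and the total sums agree. -/
def Majorizes {n : ℕ} (a b : Fin n → ℕ) : Prop :=
  (∀ k : Fin n, ∑ i ∈ Finset.Iic k, b i ≤ ∑ i ∈ Finset.Iic k, a i) ∧ ∑ i, a i = ∑ i, b i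

/-- The parts of a partition of `d` in decreasing order, padded with zeros to length `d`
(a partition of `d` has at most `d` parts). -/
def toTuple {d : ℕ} (lam : d.Partition) : Fin d → ℕ :=
  fun i => (lam.parts.sort (· ≥ ·)).getD i 0

/-- The dominance order on the partitions of `d`. -/
def Dominates {d : ℕ} (lam mu : d.Partition) : Prop :=
  Majorizes (toTuple lam) (toTuple mu)

/-- An `n`-tuple as a partition of its sum (zeros are dropped). -/
def toPartition {n : ℕ} (lam : P n) : (∑ i, lam.1 i).Partition :=
  Nat.Partition.ofSums _ (Finset.univ.val.map lam.1) rfl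

/-- The partition `(p, q)` with `p ≥ q`, of length at most two. -/
def pair (p q : ℕ) (h : q ≤ p) : P 2 :=
  ⟨![p, q], by
    intro i j hij
    fin_cases i <;> fin_cases j <;> simp_all⟩

/-! ### The ring of symmetric functions -/

/-- The ring of symmetric functions (in infinitely many variables) over `ℚ(τ)`, as the polynomial
ring `ℚ(τ)[p₁, p₂, …]` in the power sums: the variable with index `k` is `p_k`. -/
abbrev SymFun : Type := MvPolynomial ℕ+ F

/-- A symmetric function restricted to `n` variables: `p_k ↦ x_1 ^ k + ⋯ + x_n ^ k`. -/
def restrict (n : ℕ) : SymFun →ₐ[F] MvPolynomial (Fin n) F :=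
  MvPolynomial.aeval fun k : ℕ+ => MvPolynomial.psum (Fin n) F (k : ℕ)

/-- `z_λ = ∏_k k ^ {m_k} m_k!`, where `m_k` is the multiplicity of the part `k`. -/
def zee (m : ℕ+ →₀ ℕ) : ℕ := m.prod fun k e => (k : ℕ) ^ e * e.factorial

/-- The `τ`-Hall scalar product: the power-sum products `p_λ` (the monomials of `SymFun`) are
orthogonal, and `⟨p_λ, p_λ⟩ = z_λ τ ^ {-ℓ(λ)}`. -/
def hall (f g : SymFun) : F :=
  ∑ m ∈ f.support, f.coeff m * g.coeff m * ((zee m : F) * (tau ^ (m.sum fun _ e => e))⁻¹)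

/-- `f = ∑_μ K μ m_μ` in the ring of symmetric functions: the expansion holds in every number of
variables. -/
def HasMonomialExpansion {d : ℕ} (f : SymFun) (K : d.Partition → F) : Prop :=
  ∀ n : ℕ, restrict n f = ∑ mu : d.Partition, K mu • MvPolynomial.msymm (Fin n) F mu

/-- `f` is the Jack symmetric function `P_λ(τ)`: it is `m_λ` plus a combination of the `m_μ` with
`μ` strictly below `λ` in the dominance order, and it is orthogonal, for the `τ`-Hall scalar
product, to every combination of those `m_μ`. (If a family `(P_λ)` is unitriangular in the `m_μ`,
then the `P_μ` and the `m_μ`, `μ` strictly below `λ`, span the same space. So a unitriangular family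
of pairwise orthogonal symmetric functions satisfies this condition; and it has only one solution
for each `λ`, because the scalar product is anisotropic.) -/
def IsJack {d : ℕ} (lam : d.Partition) (f : SymFun) : Prop :=
  (∃ K : d.Partition → F, HasMonomialExpansion f K ∧ K lam = 1 ∧
    ∀ mu, K mu ≠ 0 → Dominates lam mu) ∧
  ∀ (g : SymFun) (K : d.Partition → F), HasMonomialExpansion g K →
    (∀ mu, K mu ≠ 0 → Dominates lam mu ∧ mu ≠ lam) → hall f g = 0

open Classical in
/-- The Jack symmetric function `P_λ(τ)`, with parameter `τ = 1 / α`. -/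
def jackFunction {d : ℕ} (lam : d.Partition) : SymFun :=
  if h : ∃ f : SymFun, IsJack lam f then h.choose else 0

/-! ### Symmetric polynomials in `n` variables -/

/-- The Jack polynomial `P_λ(x_1, …, x_n; τ)`, monic in `m_λ`. -/
def jack {n : ℕ} (lam : P n) : MvPolynomial (Fin n) F :=
  restrict n (jackFunction (toPartition lam))

/-- The monomial symmetric polynomial `m_λ(x_1, …, x_n)`. -/
def monomialSym {n : ℕ} (lam : P n) : MvPolynomial (Fin n) F :=
  MvPolynomial.msymm (Fin n) F (toPartition lam)

/-- `f(x) / f(1, …, 1)`. -/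
def normalized {n : ℕ} (f : MvPolynomial (Fin n) F) : MvPolynomial (Fin n) F :=
  (MvPolynomial.eval (fun _ => (1 : F)) f)⁻¹ • f

/-- The field of rational functions in `x_1, …, x_n` over `ℚ(τ)`. -/
abbrev RatX (n : ℕ) : Type := FractionRing (MvPolynomial (Fin n) F)

/-- A polynomial in `x_1, …, x_n` as a rational function. -/
abbrev toRatX {n : ℕ} (f : MvPolynomial (Fin n) F) : RatX n :=
  algebraMap (MvPolynomial (Fin n) F) (RatX n) f

/-- The Schur polynomial
`s_ν(x) = det (x_i ^ (ν_j + n - j))_{i,j} / det (x_i ^ (n - j))_{i,j}`, `1 ≤ i, j ≤ n`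
(the indices of `Fin n` start at `0`). -/
def schur {n : ℕ} (nu : P n) : RatX n :=
  toRatX (Matrix.det (Matrix.of fun i j : Fin n =>
      (X i : MvPolynomial (Fin n) F) ^ (nu.1 j + (n - 1 - (j : ℕ))))) /
    toRatX (Matrix.det (Matrix.of fun i j : Fin n =>
      (X i : MvPolynomial (Fin n) F) ^ (n - 1 - (j : ℕ))))

/-- The Vandermonde product `V(x) = ∏_{i < j} (x_i - x_j)`. -/
def vandermonde (n : ℕ) : MvPolynomial (Fin n) F :=
  ∏ i : Fin n, ∏ j ∈ Finset.Ioi i, (X i - X j)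

end JackPoly

end

open JackPoly

/-! Write `G_m^s = ∑_{i+j=m} ((s)_i/i!) ((s)_j/j!) x_1^i x_2^j` (a homogeneous Gegenbauer
polynomial). The theorem rests on three facts.

In two variables, `P_λ` is a scalar multiple of `(x_1 x_2)^{λ_2} G_{λ_1-λ_2}^τ` (`jack_eq_biv`). The
Jack function is defined by orthogonality, so this goes through the Laplace–Beltrami operator `D`.
Written in power sums, `D` is self-adjoint for the Hall product (`hall_laplace`). Written in
variables (`restrict_laplace`), it preserves degree and does not raise the largest exponent. When
`λ` has at most two parts, dominance below `λ` only bounds the largest part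
(`dominates_toPartition_iff`), so `D` preserves the span of the `m_μ` below `λ` and also the span of
those strictly below. Since the form is anisotropic, `P_λ` is an eigenvector (`IsJack.laplace_eq`).
In two variables the eigenvalue equation is a two-term recurrence for the coefficients, which has an
explicit solution.

The contiguous relation `gegenbauer_contiguous` expresses a combination of `G_{k+2}^τ` and `x_1 x_2
G_k^τ` as a positive multiple of `(x_1-x_2)^2 G_k^{τ+1}`. Evaluating it at `(1,1)` shows that the
two coefficients are exactly those of the normalization. Hence for neighbouring partitions the
quotient in question is a positive multiple of `(x_1 x_2)^q G_k^{τ+1}`; the general case telescopes.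

The Schur coefficients of `G_k^{τ+1}` are differences of consecutive coefficients towards the
middle, and each is a product of positive factors (`schurPositive_gegenbauer`). Uniqueness is the
linear independence of Schur polynomials. The statement on the `M_λ` is a direct factorization. -/

noncomputable section

namespace JackPoly

/-! ### The Hall scalar product -/

/-- The norm `z_λ τ ^ {-ℓ(λ)}` of the power-sum product with exponent vector `m`. -/
def hallWeight (m : ℕ+ →₀ ℕ) : F := (zee m : F) * (tau ^ (m.sum fun _ e => e))⁻¹

/-- The Hall scalar product as a bilinear form. -/
def hallForm : SymFun →ₗ[F] SymFun →ₗ[F] F :=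
  (basisMonomials ℕ+ F).constr F fun m => hallWeight m • lcoeff F m

theorem hallForm_monomial (m : ℕ+ →₀ ℕ) (a : F) (g : SymFun) :
    hallForm (monomial m a) g = a * (hallWeight m * g.coeff m) := by
  have h : (monomial m a : SymFun) = a • basisMonomials ℕ+ F m := by
    simp [smul_monomial]
  rw [h, map_smul, hallForm, Module.Basis.constr_basis]
  simp

theorem hallForm_eq_hall (f g : SymFun) : hallForm f g = hall f g := by
  conv_lhs => rw [f.as_sum]
  rw [map_sum, LinearMap.sum_apply, hall]
  refine Finset.sum_congr rfl fun m _ => ?_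
  rw [hallForm_monomial, hallWeight]
  ring

theorem hall_comm (f g : SymFun) : hall f g = hall g f := by
  have h : ∀ f g : SymFun, hall f g = ∑ m ∈ f.support ∪ g.support,
      f.coeff m * g.coeff m * hallWeight m := by
    intro f g
    refine Finset.sum_subset Finset.subset_union_left fun m _ hm => ?_
    rw [notMem_support_iff.mp hm]
    simp
  rw [h f g, h g f, Finset.union_comm]
  exact Finset.sum_congr rfl fun m _ => by ring

theorem tau_ne_zero : tau ≠ 0 := RatFunc.X_ne_zero

/-- A new part `k` multiplies `z_λ` by `k (m_k + 1)` and lengthens `λ` by one. The factor `m_k + 1`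
is the one produced by `∂/∂p_k`, whence the adjointness of `p_k` and `(k/τ) ∂/∂p_k`. -/
theorem hallWeight_add_single (m : ℕ+ →₀ ℕ) (k : ℕ+) :
    hallWeight (m + Finsupp.single k 1) = hallWeight m * ((k : ℕ) * (m k + 1) / tau) := by
  have hz : zee (m + Finsupp.single k 1) = zee m * ((k : ℕ) * (m k + 1)) := by
    classical
    have h0 : ∀ m : ℕ+ →₀ ℕ, zee m = ((m.erase k).prod fun k e => (k : ℕ) ^ e * e.factorial) *
        ((k : ℕ) ^ m k * (m k).factorial) := by
      intro m
      rw [zee, mul_comm]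
      exact (Finsupp.mul_prod_erase' m k (fun (k : ℕ+) e => (k : ℕ) ^ e * e.factorial)
        (by simp)).symm
    rw [h0 (m + Finsupp.single k 1), h0 m]
    have : (m + Finsupp.single k 1).erase k = m.erase k := by
      rw [Finsupp.erase_add]; simp
    rw [this]
    simp only [Finsupp.add_apply, Finsupp.single_eq_same, Nat.factorial_succ]
    ring
  have hs : ((m + Finsupp.single k 1).sum fun _ e => e) = (m.sum fun _ e => e) + 1 := by
    rw [Finsupp.sum_add_index' (by simp) (by simp)]
    simp
  have := tau_ne_zero
  rw [hallWeight, hallWeight, hz, hs]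
  push_cast
  field_simp
  rw [pow_succ, mul_assoc]

/-- Multiplication by `p_k` is adjoint to `(k / τ) ∂ / ∂ p_k`. -/
theorem hall_X_mul (k : ℕ+) (f g : SymFun) :
    hall (X k * f) g = (k : ℕ) / tau * hall f (pderiv k g) := by
  simp only [← hallForm_eq_hall]
  induction f using MvPolynomial.induction_on' with
  | monomial m a =>
    have h : (X k * monomial m a : SymFun) = monomial (m + Finsupp.single k 1) a := by
      rw [X, monomial_mul, add_comm, one_mul]
    rw [h, hallForm_monomial, hallForm_monomial, coeff_pderiv, hallWeight_add_single]
    ring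
  | add p q hp hq => simp only [mul_add, map_add, LinearMap.add_apply, hp, hq]

theorem hall_X_mul_right (k : ℕ+) (f g : SymFun) :
    hall f (X k * g) = (k : ℕ) / tau * hall (pderiv k f) g := by
  rw [hall_comm, hall_X_mul, hall_comm]

theorem hall_add_left (f g h : SymFun) : hall (f + g) h = hall f h + hall g h := by
  simp only [← hallForm_eq_hall, map_add, LinearMap.add_apply]

theorem hall_add_right (f g h : SymFun) : hall f (g + h) = hall f g + hall f h := by
  simp only [← hallForm_eq_hall, map_add]

theorem hall_smul_left (a : F) (f g : SymFun) : hall (a • f) g = a * hall f g := by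
  simp only [← hallForm_eq_hall, map_smul, LinearMap.smul_apply, smul_eq_mul]

theorem hall_smul_right (a : F) (f g : SymFun) : hall f (a • g) = a * hall f g := by
  simp only [← hallForm_eq_hall, map_smul, smul_eq_mul]

theorem hall_sub_left (f g h : SymFun) : hall (f - g) h = hall f h - hall g h := by
  simp only [← hallForm_eq_hall, map_sub, LinearMap.sub_apply]

theorem hall_sum_left {ι : Type*} (s : Finset ι) (f : ι → SymFun) (g : SymFun) :
    hall (∑ i ∈ s, f i) g = ∑ i ∈ s, hall (f i) g := by
  simp only [← hallForm_eq_hall, map_sum, LinearMap.sum_apply]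

theorem hall_sum_right {ι : Type*} (s : Finset ι) (f : ι → SymFun) (g : SymFun) :
    hall g (∑ i ∈ s, f i) = ∑ i ∈ s, hall g (f i) := by
  simp only [← hallForm_eq_hall, map_sum]

/-- Sending `τ` to a positive transcendental number, here Liouville's, makes `ℚ(τ)` a subfield of
`ℝ`. Positivity arguments over `ℝ` then give nonvanishing in `ℚ(τ)`. -/
theorem exists_real_embedding : ∃ φ : F →+* ℝ, 0 < φ tau := by
  have ht : Transcendental ℚ (liouvilleNumber (2 : ℕ)) := by
    have := transcendental_liouvilleNumber (m := 2) le_rfl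
    intro h
    exact this ((IsFractionRing.isAlgebraic_iff ℤ ℚ ℝ).mpr h)
  have hinj := transcendental_iff_injective.mp ht
  refine ⟨IsFractionRing.lift (A := Polynomial ℚ) (K := F)
    (g := (Polynomial.aeval (R := ℚ) (liouvilleNumber (2 : ℕ))).toRingHom) hinj, ?_⟩
  have : tau = algebraMap (Polynomial ℚ) F Polynomial.X := (RatFunc.algebraMap_X).symm
  rw [this, IsFractionRing.lift_algebraMap]
  simp only [AlgHom.toRingHom_eq_coe, RingHom.coe_coe, Polynomial.aeval_X]
  exact (LiouvilleNumber.summable (by norm_num)).tsum_pos (fun _ => by positivity) 0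
    (by positivity)

/-- The scalar product is anisotropic. -/
theorem hall_self_eq_zero {f : SymFun} (h : hall f f = 0) : f = 0 := by
  obtain ⟨φ, hφ⟩ := exists_real_embedding
  have h1 : φ (hall f f) = 0 := by rw [h, map_zero]
  rw [hall, map_sum] at h1
  have hpos : ∀ m : ℕ+ →₀ ℕ, 0 < φ (hallWeight m) := by
    intro m
    rw [hallWeight, map_mul, map_natCast, map_inv₀, map_pow]
    have : 0 < zee m := Finset.prod_pos fun k _ => by positivity
    positivity
  have h2 : ∀ m, φ (f.coeff m * f.coeff m * hallWeight m) =
      φ (f.coeff m) * φ (f.coeff m) * φ (hallWeight m) := fun m => by simp only [map_mul]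
  ext m
  rw [coeff_zero]
  by_contra hm
  have h3 := (Finset.sum_eq_zero_iff_of_nonneg (fun m _ => ?_)).mp h1 m (mem_support_iff.mpr hm)
  · change φ (f.coeff m * f.coeff m * hallWeight m) = 0 at h3
    rw [h2] at h3
    have := (hpos m).ne'
    simp_all
  · change 0 ≤ φ (f.coeff m * f.coeff m * hallWeight m)
    rw [h2]
    exact mul_nonneg (mul_self_nonneg _) (hpos m).le

/-! ### The Laplace–Beltrami operator -/

/-- The Laplace–Beltrami operator on symmetric functions in `p_1, …, p_N`. -/
def laplace (N : ℕ) (f : SymFun) : SymFun :=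
  (∑ k ∈ range N, ∑ l ∈ range N,
    (((k + 1) * (l + 1) : F) • (X (k.succPNat + l.succPNat) *
        pderiv k.succPNat (pderiv l.succPNat f)) +
      (tau * (k + l + 2) : F) • (X k.succPNat * (X l.succPNat *
        pderiv (k.succPNat + l.succPNat) f)))) +
    ∑ k ∈ range N, ((1 - tau) * (k + 1) ^ 2 : F) • (X k.succPNat * pderiv k.succPNat f)

theorem pderiv_pderiv_comm {σ R : Type*} [CommSemiring R] (i j : σ) (f : MvPolynomial σ R) :
    pderiv i (pderiv j f) = pderiv j (pderiv i f) := by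
  classical
  rcases eq_or_ne i j with rfl | h
  · rfl
  ext m
  simp only [coeff_pderiv, Finsupp.add_apply, Finsupp.single_eq_of_ne h,
    Finsupp.single_eq_of_ne h.symm, add_right_comm m]
  push_cast
  ring

/-- Taking adjoints exchanges the joining term `k l p_{k+l} ∂_k ∂_l` with the cutting term `τ (k+l)
p_k p_l ∂_{k+l}`, and fixes each `p_k ∂_k`. -/
theorem hall_laplace (N : ℕ) (f g : SymFun) :
    hall (laplace N f) g = hall f (laplace N g) := by
  have := tau_ne_zero
  simp only [laplace, hall_add_left, hall_add_right, hall_sum_left, hall_sum_right,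
    hall_smul_left, hall_smul_right, hall_X_mul, hall_X_mul_right]
  congr 1
  refine Finset.sum_congr rfl fun k _ => Finset.sum_congr rfl fun l _ => ?_
  rw [pderiv_pderiv_comm k.succPNat l.succPNat f, pderiv_pderiv_comm k.succPNat l.succPNat g]
  simp only [PNat.add_coe, Nat.succPNat_coe, Nat.succ_eq_add_one]
  push_cast
  field_simp
  ring

/-! ### Restriction to finitely many variables -/

/-- The Euler operator `x_i ∂ / ∂ x_i`. -/
def theta {n : ℕ} (i : Fin n) (p : MvPolynomial (Fin n) F) : MvPolynomial (Fin n) F :=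
  X i * pderiv i p

theorem theta_add {n : ℕ} (i : Fin n) (p q : MvPolynomial (Fin n) F) :
    theta i (p + q) = theta i p + theta i q := by
  simp only [theta, map_add, mul_add]

theorem theta_sum {n : ℕ} {ι : Type*} (i : Fin n) (s : Finset ι)
    (p : ι → MvPolynomial (Fin n) F) : theta i (∑ k ∈ s, p k) = ∑ k ∈ s, theta i (p k) := by
  simp only [theta, map_sum, mul_sum]

theorem theta_smul {n : ℕ} (i : Fin n) (a : F) (p : MvPolynomial (Fin n) F) :
    theta i (a • p) = a • theta i p := by
  simp only [theta, Derivation.map_smul, mul_smul_comm]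

theorem theta_mul {n : ℕ} (i : Fin n) (p q : MvPolynomial (Fin n) F) :
    theta i (p * q) = theta i p * q + p * theta i q := by
  simp only [theta, pderiv_mul]
  ring

theorem theta_X_pow {n : ℕ} (i : Fin n) (k : ℕ) :
    theta i (X i ^ k : MvPolynomial (Fin n) F) = (k : F) • X i ^ k := by
  cases k with
  | zero => simp [theta]
  | succ k =>
    simp only [theta, pderiv_pow, pderiv_X_self, smul_eq_C_mul]
    simp
    ring

theorem coeff_theta {n : ℕ} (i : Fin n) (p : MvPolynomial (Fin n) F) (m : Fin n →₀ ℕ) :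
    (theta i p).coeff m = (m i : F) * p.coeff m := by
  classical
  rw [theta, mul_comm, coeff_mul_X', coeff_pderiv]
  split_ifs with h
  · have h1 : 1 ≤ m i := Nat.one_le_iff_ne_zero.mpr (Finsupp.mem_support_iff.mp h)
    have h2 : m - Finsupp.single i 1 + Finsupp.single i 1 = m :=
      tsub_add_cancel_of_le (Finsupp.single_le_iff.mpr h1)
    rw [h2, Finsupp.tsub_apply, Finsupp.single_eq_same, Nat.cast_sub h1]
    push_cast
    ring
  · rw [Finsupp.notMem_support_iff.mp h]
    simp

theorem theta_psum {n : ℕ} (i : Fin n) (k : ℕ) :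
    theta i (psum (Fin n) F k) = (k : F) • X i ^ k := by
  rw [psum, theta_sum, Finset.sum_eq_single i, theta_X_pow]
  · intro j _ hj
    rw [theta, pderiv_pow, pderiv_X_of_ne hj]
    simp
  · simp

/-- The symmetric functions in `p_1, …, p_N`. -/
def powerSumSubalgebra (N : ℕ) : Subalgebra F SymFun :=
  Algebra.adjoin F ((fun k : ℕ => (X k.succPNat : SymFun)) '' (range N : Set ℕ))

/-- Each symmetric function involves finitely many power sums, so the truncated sums in `laplace N`
lose nothing once `N` is large. -/
theorem exists_mem_powerSumSubalgebra (f : SymFun) : ∃ N, ∀ N', N ≤ N' →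
    f ∈ powerSumSubalgebra N' := by
  induction f using MvPolynomial.induction_on with
  | C a => exact ⟨0, fun N' _ => Subalgebra.algebraMap_mem _ a⟩
  | add p q hp hq =>
    obtain ⟨N₁, h₁⟩ := hp
    obtain ⟨N₂, h₂⟩ := hq
    exact ⟨max N₁ N₂, fun N' h => add_mem (h₁ N' (le_trans (le_max_left _ _) h))
      (h₂ N' (le_trans (le_max_right _ _) h))⟩
  | mul_X p k hp =>
    obtain ⟨N₁, h₁⟩ := hp
    refine ⟨max N₁ k, fun N' h => mul_mem (h₁ N' (le_trans (le_max_left _ _) h)) ?_⟩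
    refine Algebra.subset_adjoin ⟨k.natPred, ?_, by simp⟩
    have : (k : ℕ) ≤ N' := le_trans (le_max_right _ _) h
    have h2 : k.natPred + 1 = k := k.natPred_add_one
    simp only [coe_range, Set.mem_Iio]
    omega

theorem pderiv_eq_zero_of_mem {N : ℕ} {f : SymFun} (hf : f ∈ powerSumSubalgebra N) {k : ℕ}
    (hk : N ≤ k) : pderiv k.succPNat f = 0 := by
  induction hf using Algebra.adjoin_induction with
  | mem x hx =>
    obtain ⟨l, hl, rfl⟩ := hx
    refine pderiv_X_of_ne fun h => ?_
    have := Nat.succPNat_injective h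
    simp at hl
    omega
  | algebraMap r => exact pderiv_C
  | add x y _ _ hx hy => rw [map_add, hx, hy, add_zero]
  | mul x y _ _ hx hy => rw [pderiv_mul, hx, hy]; simp

theorem pderiv_mem {N : ℕ} {f : SymFun} (hf : f ∈ powerSumSubalgebra N) (k : ℕ+) :
    pderiv k f ∈ powerSumSubalgebra N := by
  classical
  induction hf using Algebra.adjoin_induction with
  | mem x hx =>
    obtain ⟨l, hl, rfl⟩ := hx
    simp only [pderiv_X, Pi.single_apply]
    split_ifs <;> simp
  | algebraMap r =>
    have : pderiv k (algebraMap F SymFun r) = 0 := pderiv_C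
    rw [this]
    exact zero_mem _
  | add x y _ _ hx hy => rw [map_add]; exact add_mem hx hy
  | mul x y hx' hy' hx hy =>
    rw [pderiv_mul]
    exact add_mem (mul_mem hx hy') (mul_mem hx' hy)

/-- The chain rule. -/
theorem theta_restrict {N n : ℕ} {f : SymFun} (hf : f ∈ powerSumSubalgebra N) (i : Fin n) :
    theta i (restrict n f) =
      ∑ k ∈ range N, (k + 1 : F) • (X i ^ (k + 1) * restrict n (pderiv k.succPNat f)) := by
  classical
  induction hf using Algebra.adjoin_induction with
  | mem x hx =>
    obtain ⟨l, hl, rfl⟩ := hx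
    rw [Finset.sum_eq_single l]
    · have : restrict n (X l.succPNat) = psum (Fin n) F (l + 1) := by simp [restrict]
      rw [this, theta_psum]
      simp
    · intro k _ hk
      rw [pderiv_X_of_ne fun h => hk (Nat.succPNat_injective h).symm]
      simp
    · intro h
      exact absurd hl h
  | algebraMap r =>
    have (k : ℕ) : pderiv k.succPNat (algebraMap F SymFun r) = 0 := pderiv_C
    simp [theta]
  | add x y _ _ hx hy =>
    simp only [map_add, theta_add, hx, hy, mul_add, smul_add, sum_add_distrib]
  | mul x y _ _ hx hy =>
    simp only [map_mul, theta_mul, hx, hy, pderiv_mul, map_add, mul_add, smul_add,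
      sum_add_distrib, sum_mul, mul_sum]
    congr 1
    · refine sum_congr rfl fun k _ => ?_
      rw [smul_mul_assoc, mul_assoc]
    · refine sum_congr rfl fun k _ => ?_
      rw [mul_smul_comm, mul_left_comm]

theorem theta_theta_restrict {N n : ℕ} {f : SymFun} (hf : f ∈ powerSumSubalgebra N)
    (i : Fin n) : theta i (theta i (restrict n f)) =
      (∑ k ∈ range N, ∑ l ∈ range N, ((k + 1) * (l + 1) : F) •
        (X i ^ (k + l + 2) * restrict n (pderiv k.succPNat (pderiv l.succPNat f)))) +
      ∑ k ∈ range N, ((k + 1) ^ 2 : F) • (X i ^ (k + 1) * restrict n (pderiv k.succPNat f)) := by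
  rw [theta_restrict hf, theta_sum, add_comm, ← sum_add_distrib]
  refine sum_congr rfl fun k _ => ?_
  rw [theta_smul, theta_mul, theta_X_pow, theta_restrict (pderiv_mem hf _), smul_add, mul_sum,
    smul_sum, smul_mul_assoc, smul_smul, sq, Nat.cast_add, Nat.cast_one]
  refine congrArg₂ _ rfl (sum_congr rfl fun l _ => ?_)
  rw [mul_smul_comm, smul_smul, ← mul_assoc, ← pow_add, pderiv_pderiv_comm,
    show k + 1 + (l + 1) = k + l + 2 by omega]

/-- The divided difference `(x_i ∂_i - x_j ∂_j) / (x_i - x_j)` of `restrict n f`. -/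
def dividedTheta (N : ℕ) {n : ℕ} (f : SymFun) (i j : Fin n) : MvPolynomial (Fin n) F :=
  ∑ k ∈ range N, (k + 1 : F) •
    ((∑ a ∈ range (k + 1), X i ^ a * X j ^ (k - a)) * restrict n (pderiv k.succPNat f))

theorem dividedTheta_mul_sub {N n : ℕ} {f : SymFun} (hf : f ∈ powerSumSubalgebra N)
    (i j : Fin n) : dividedTheta N f i j * (X i - X j) =
      theta i (restrict n f) - theta j (restrict n f) := by
  rw [theta_restrict hf, theta_restrict hf, ← sum_sub_distrib, dividedTheta, sum_mul]
  refine sum_congr rfl fun k _ => ?_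
  have h := (Commute.all (X i : MvPolynomial (Fin n) F) (X j)).geom_sum₂_mul (k + 1)
  simp only [Nat.add_sub_cancel] at h
  rw [← smul_sub, ← sub_mul, ← h, smul_mul_assoc, mul_right_comm]

/-- Multiplying the geometric sum by `x_i` or by `x_j` and summing over all `i`, `j` gives products
`p_a p_b` with `a + b = k + 1`. The term `n p_{k+1}` is the extreme one, where `p_0 = n`. -/
theorem sum_add_mul_geom {n : ℕ} (k : ℕ) :
    ∑ i : Fin n, ∑ j : Fin n, (X i + X j) * ∑ a ∈ range (k + 1), X i ^ a * X j ^ (k - a) =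
      (2 : MvPolynomial (Fin n) F) * (n * psum (Fin n) F (k + 1) +
        ∑ a ∈ range k, psum (Fin n) F (a + 1) * psum (Fin n) F (k - a)) := by
  have h0 : psum (Fin n) F 0 = n := by simp
  have h1 : ∑ i : Fin n, ∑ j : Fin n, (X i + X j) *
      ∑ a ∈ range (k + 1), X i ^ a * X j ^ (k - a) =
      ∑ a ∈ range (k + 1), psum (Fin n) F (a + 1) * psum (Fin n) F (k - a) +
      ∑ a ∈ range (k + 1), psum (Fin n) F a * psum (Fin n) F (k - a + 1) := by
    simp only [mul_sum]
    simp_rw [sum_comm (s := (univ : Finset (Fin n))) (t := range (k + 1))]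
    rw [← sum_add_distrib]
    refine sum_congr rfl fun a _ => ?_
    simp only [psum, sum_mul_sum, ← sum_add_distrib]
    refine sum_congr rfl fun i _ => sum_congr rfl fun j _ => ?_
    ring
  rw [h1, sum_range_succ, sum_range_succ' _ k]
  have h2 : ∑ a ∈ range k, psum (Fin n) F (a + 1) * psum (Fin n) F (k - (a + 1) + 1) =
      ∑ a ∈ range k, psum (Fin n) F (a + 1) * psum (Fin n) F (k - a) := by
    refine sum_congr rfl fun a ha => ?_
    rw [show k - (a + 1) + 1 = k - a by have := mem_range.mp ha; omega]
  rw [h2, Nat.sub_self, Nat.sub_zero, h0]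
  ring

/-- Reindexing by the index of `p_{(k+1)+(l+1)}`, which is `k + l + 1` because the index `k` stands
for `p_{k+1}`. -/
theorem sum_range_sum_range_eq {M : Type*} [AddCommMonoid M] (N : ℕ) (G : ℕ → ℕ → M)
    (hG : ∀ k l, N ≤ k + l + 1 → G k l = 0) :
    ∑ k ∈ range N, ∑ l ∈ range N, G k l = ∑ j ∈ range N, ∑ a ∈ range j, G a (j - 1 - a) := by
  rw [← sum_product', sum_sigma']
  rw [← sum_filter_of_ne (p := fun x : ℕ × ℕ => x.1 + x.2 + 1 < N)
    fun x _ hx => by by_contra h; exact hx (hG _ _ (by omega))]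
  refine sum_nbij' (fun x => ⟨x.1 + x.2 + 1, x.1⟩) (fun y => (y.2, y.1 - 1 - y.2)) ?_ ?_ ?_ ?_ ?_
  · rintro ⟨k, l⟩ h
    simp at h ⊢
    omega
  · rintro ⟨j, a⟩ h
    simp at h ⊢
    omega
  · rintro ⟨k, l⟩ h
    simp
  · rintro ⟨j, a⟩ h
    simp at h ⊢
    omega
  · rintro ⟨k, l⟩ h
    simp only
    congr 1
    omega

theorem succPNat_add (k l : ℕ) : k.succPNat + l.succPNat = (k + l + 1).succPNat := by
  apply PNat.eq
  simp only [PNat.add_coe, Nat.succPNat_coe]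
  omega

theorem restrict_X (n k : ℕ) : restrict n (X k.succPNat) = psum (Fin n) F (k + 1) := by
  simp [restrict]

theorem sum_theta_theta {N n : ℕ} {f : SymFun} (hf : f ∈ powerSumSubalgebra N) :
    ∑ i, theta i (theta i (restrict n f)) =
      (∑ k ∈ range N, ∑ l ∈ range N, ((k + 1) * (l + 1) : F) •
        (psum (Fin n) F (k + l + 2) *
          restrict n (pderiv k.succPNat (pderiv l.succPNat f)))) +
      ∑ k ∈ range N, ((k + 1) ^ 2 : F) •
        (psum (Fin n) F (k + 1) * restrict n (pderiv k.succPNat f)) := by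
  simp only [theta_theta_restrict hf, sum_add_distrib]
  congr 1
  · rw [sum_comm]
    refine sum_congr rfl fun k _ => ?_
    rw [sum_comm]
    refine sum_congr rfl fun l _ => ?_
    rw [← smul_sum, ← sum_mul, psum]
  · rw [sum_comm]
    refine sum_congr rfl fun k _ => ?_
    rw [← smul_sum, ← sum_mul, psum]

theorem sum_theta {N n : ℕ} {f : SymFun} (hf : f ∈ powerSumSubalgebra N) :
    ∑ i, theta i (restrict n f) = ∑ k ∈ range N, (k + 1 : F) •
        (psum (Fin n) F (k + 1) * restrict n (pderiv k.succPNat f)) := by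
  simp only [theta_restrict hf]
  rw [sum_comm]
  refine sum_congr rfl fun k _ => ?_
  rw [← smul_sum, ← sum_mul, psum]

theorem sum_add_mul_dividedTheta (N n : ℕ) (f : SymFun) :
    ∑ i : Fin n, ∑ j : Fin n, (X i + X j) * dividedTheta N f i j =
      ∑ k ∈ range N, (2 * (k + 1) : F) • ((n * psum (Fin n) F (k + 1) +
        ∑ a ∈ range k, psum (Fin n) F (a + 1) * psum (Fin n) F (k - a)) *
          restrict n (pderiv k.succPNat f)) := by
  have h : ∀ i j : Fin n, (X i + X j) * dividedTheta N f i j = ∑ k ∈ range N, (k + 1 : F) •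
      (((X i + X j) * ∑ a ∈ range (k + 1), X i ^ a * X j ^ (k - a)) *
        restrict n (pderiv k.succPNat f)) := by
    intro i j
    rw [dividedTheta, mul_sum]
    refine sum_congr rfl fun k _ => ?_
    rw [mul_smul_comm, mul_assoc]
  simp only [h]
  simp_rw [sum_comm (s := (univ : Finset (Fin n))) (t := range N)]
  refine sum_congr rfl fun k _ => ?_
  simp only [← smul_sum, ← sum_mul]
  rw [sum_add_mul_geom, mul_comm (2 : F), mul_smul, ofNat_smul_eq_nsmul, nsmul_eq_mul, mul_assoc]
  norm_num

theorem sum_diag_dividedTheta (N n : ℕ) (f : SymFun) :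
    ∑ i : Fin n, (X i + X i) * dividedTheta N f i i =
      ∑ k ∈ range N, (2 * (k + 1) ^ 2 : F) • (psum (Fin n) F (k + 1) *
          restrict n (pderiv k.succPNat f)) := by
  have h : ∀ i : Fin n, (X i + X i) * dividedTheta N f i i =
      ∑ k ∈ range N, (2 * (k + 1) ^ 2 : F) • (X i ^ (k + 1) *
          restrict n (pderiv k.succPNat f)) := by
    intro i
    rw [dividedTheta, mul_sum]
    refine sum_congr rfl fun k _ => ?_
    have h1 : ∑ a ∈ range (k + 1), (X i ^ a * X i ^ (k - a) : MvPolynomial (Fin n) F) =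
        (k + 1 : F) • X i ^ k := by
      rw [sum_congr rfl (g := fun _ => X i ^ k), sum_const, card_range, ← Nat.cast_smul_eq_nsmul F]
      · simp
      · intro a ha
        rw [← pow_add]
        congr 1
        have := mem_range.mp ha
        omega
    have h2 : (X i + X i) * (X i ^ k * restrict n (pderiv k.succPNat f)) =
        (2 : F) • (X i ^ (k + 1) * restrict n (pderiv k.succPNat f)) := by
      rw [pow_succ', two_smul]
      ring
    rw [h1, mul_smul_comm, smul_mul_assoc, mul_smul_comm, smul_smul, h2, smul_smul]
    refine congrArg₂ _ ?_ rfl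
    ring
  simp only [h]
  rw [sum_comm]
  refine sum_congr rfl fun k _ => ?_
  rw [← smul_sum, ← sum_mul, psum]

/-- The contribution of a single `∂/∂p_{k+1}` to `restrict_laplace`. Removing the diagonal `i = j`
turns `(k+1)^2` into `(1-t)(k+1)^2`; the last term cancels the `n` coming from `p_0`. -/
theorem laplace_coefficient_identity {K M : Type*} [Field K] [CharZero K] [AddCommGroup M]
    [Module K M] (t n k : K) (A B : M) :
    (t * (k + 1)) • B + ((1 - t) * (k + 1) ^ 2) • A = (k + 1) ^ 2 • A +
      (t / 2) • ((2 * (k + 1)) • (n • A + B) - (2 * (k + 1) ^ 2) • A) -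
      (t * n) • (k + 1) • A := by
  module

/-- The operator in variables is `∑ θ_i^2 + (τ/2) ∑_{i≠j} (x_i+x_j)/(x_i-x_j) (θ_i-θ_j) - τ n ∑
θ_i`. The last term is what makes the power-sum form independent of `n`. -/
theorem restrict_laplace {N n : ℕ} {f : SymFun} (hf : f ∈ powerSumSubalgebra N) :
    restrict n (laplace N f) = ∑ i, theta i (theta i (restrict n f)) +
      (tau / 2) • ∑ i : Fin n, ∑ j ∈ univ.erase i, (X i + X j) * dividedTheta N f i j -
      (tau * n) • ∑ i, theta i (restrict n f) := by
  have h1 : ∑ i : Fin n, ∑ j ∈ univ.erase i, (X i + X j) * dividedTheta N f i j =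
      ∑ i : Fin n, ∑ j : Fin n, (X i + X j) * dividedTheta N f i j -
      ∑ i : Fin n, (X i + X i) * dividedTheta N f i i := by
    rw [← sum_sub_distrib]
    refine sum_congr rfl fun i _ => ?_
    rw [sum_erase_eq_sub (mem_univ i)]
  have h2 : ∑ k ∈ range N, ∑ l ∈ range N, (tau * (k + l + 2) : F) • (psum (Fin n) F (k + 1) *
      (psum (Fin n) F (l + 1) * restrict n (pderiv (k + l + 1).succPNat f))) =
      ∑ k ∈ range N, (tau * (k + 1) : F) • ((∑ a ∈ range k, psum (Fin n) F (a + 1) *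
        psum (Fin n) F (k - a)) * restrict n (pderiv k.succPNat f)) := by
    rw [sum_range_sum_range_eq]
    · refine sum_congr rfl fun j _ => ?_
      rw [sum_mul, smul_sum]
      refine sum_congr rfl fun a ha => ?_
      have ha' := mem_range.mp ha
      rw [show j - 1 - a + 1 = j - a by omega, show a + (j - 1 - a) + 1 = j by omega, mul_assoc]
      congr 2
      have : ((a + (j - 1 - a) + 1 : ℕ) : F) = j := by
        congr 1
        omega
      push_cast at this
      linear_combination this
    · intro k l h
      rw [pderiv_eq_zero_of_mem hf h]
      simp
  rw [h1, sum_add_mul_dividedTheta, sum_diag_dividedTheta, sum_theta_theta hf, sum_theta hf]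
  simp only [laplace, map_add, map_sum, map_smul, map_mul, restrict_X, succPNat_add,
    sum_add_distrib]
  rw [h2]
  simp only [show ∀ k l : ℕ, k + l + 1 + 1 = k + l + 2 from fun _ _ => rfl]
  rw [add_assoc, add_assoc, add_sub_assoc]
  refine congrArg₂ _ rfl ?_
  simp only [smul_sum, ← sum_add_distrib, ← sum_sub_distrib]
  refine sum_congr rfl fun k _ => ?_
  have h3 : (n : MvPolynomial (Fin n) F) * psum (Fin n) F (k + 1) =
      (n : F) • psum (Fin n) F (k + 1) := by
    rw [Nat.cast_smul_eq_nsmul, nsmul_eq_mul]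
  rw [h3, add_mul, smul_mul_assoc]
  exact laplace_coefficient_identity tau n k _ _

/-- All exponents of `p` are at most `r`. -/
def ExponentsLE {n : ℕ} (r : ℕ) (p : MvPolynomial (Fin n) F) : Prop :=
  ∀ m ∈ p.support, ∀ i, m i ≤ r

theorem ExponentsLE.zero {n : ℕ} (r : ℕ) : ExponentsLE r (0 : MvPolynomial (Fin n) F) := by
  intro m hm
  simp at hm

theorem ExponentsLE.degreeOf_le {n r : ℕ} {p : MvPolynomial (Fin n) F} (hp : ExponentsLE r p)
    (i : Fin n) : degreeOf i p ≤ r :=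
  degreeOf_le_iff.mpr fun m hm => hp m hm i

theorem exponentsLE_of_degreeOf_le {n r : ℕ} {p : MvPolynomial (Fin n) F}
    (h : ∀ i, degreeOf i p ≤ r) : ExponentsLE r p :=
  fun m hm i => degreeOf_le_iff.mp (h i) m hm

theorem ExponentsLE.add {n r : ℕ} {p q : MvPolynomial (Fin n) F} (hp : ExponentsLE r p)
    (hq : ExponentsLE r q) : ExponentsLE r (p + q) := by
  classical
  intro m hm i
  rcases mem_union.mp (support_add hm) with h | h
  exacts [hp m h i, hq m h i]

theorem ExponentsLE.smul {n r : ℕ} {p : MvPolynomial (Fin n) F} (hp : ExponentsLE r p) (a : F) :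
    ExponentsLE r (a • p) :=
  fun m hm i => hp m (support_smul hm) i

theorem ExponentsLE.sub {n r : ℕ} {p q : MvPolynomial (Fin n) F} (hp : ExponentsLE r p)
    (hq : ExponentsLE r q) : ExponentsLE r (p - q) := by
  rw [sub_eq_add_neg, ← neg_one_smul F]
  exact hp.add (hq.smul _)

theorem ExponentsLE.sum {n r : ℕ} {ι : Type*} {s : Finset ι}
    {p : ι → MvPolynomial (Fin n) F} (hp : ∀ i ∈ s, ExponentsLE r (p i)) :
    ExponentsLE r (∑ i ∈ s, p i) := by
  classical
  induction s using Finset.induction_on with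
  | empty => exact ExponentsLE.zero r
  | insert i s hi ih =>
    rw [sum_insert hi]
    exact (hp i (mem_insert_self _ _)).add (ih fun j hj => hp j (mem_insert_of_mem hj))

theorem ExponentsLE.theta {n r : ℕ} {p : MvPolynomial (Fin n) F} (hp : ExponentsLE r p)
    (i : Fin n) : ExponentsLE r (theta i p) := by
  intro m hm j
  refine hp m ?_ j
  rw [mem_support_iff, coeff_theta] at hm
  exact mem_support_iff.mpr (right_ne_zero_of_mul hm)

theorem degreeOf_X_add_X_le {n : ℕ} {i j : Fin n} (hij : i ≠ j) (l : Fin n) :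
    degreeOf l (X i + X j : MvPolynomial (Fin n) F) ≤
      degreeOf l (X i - X j : MvPolynomial (Fin n) F) := by
  classical
  rw [degreeOf_le_iff]
  intro m hm
  refine degreeOf_le_iff.mp le_rfl m ?_
  rw [mem_support_iff, coeff_add, coeff_X, coeff_X] at hm
  rw [mem_support_iff, coeff_sub, coeff_X, coeff_X]
  have h : Finsupp.single i 1 ≠ (Finsupp.single j 1 : Fin n →₀ ℕ) := fun h =>
    hij (Finsupp.single_left_injective one_ne_zero h)
  split_ifs at hm ⊢ with h1 h2 h2
  · exact absurd (h1.trans h2.symm) h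
  all_goals simp_all

/-- Over a domain the degree in one variable is additive on products. Dividing by `x_i - x_j`
therefore lowers it by at least as much as multiplying by `x_i + x_j` can raise it. -/
theorem ExponentsLE.add_mul_dividedTheta {N n r : ℕ} {f : SymFun}
    (hf : f ∈ powerSumSubalgebra N) (h : ExponentsLE r (restrict n f)) {i j : Fin n}
    (hij : i ≠ j) : ExponentsLE r ((X i + X j) * dividedTheta N f i j) := by
  by_cases h0 : dividedTheta N f i j = 0
  · rw [h0, mul_zero]
    exact ExponentsLE.zero r
  refine exponentsLE_of_degreeOf_le fun l => ?_
  have h1 := ((h.theta i).sub (h.theta j)).degreeOf_le l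
  have h2 : (X i - X j : MvPolynomial (Fin n) F) ≠ 0 :=
    sub_ne_zero.mpr fun h => hij (X_injective h)
  rw [← dividedTheta_mul_sub hf, degreeOf_mul_eq h0 h2] at h1
  have h3 := degreeOf_mul_le l (X i + X j) (dividedTheta N f i j)
  have h4 := degreeOf_X_add_X_le hij l
  omega

/-- The Laplace–Beltrami operator does not increase exponents. -/
theorem ExponentsLE.laplace {N n r : ℕ} {f : SymFun} (hf : f ∈ powerSumSubalgebra N)
    (h : ExponentsLE r (restrict n f)) : ExponentsLE r (restrict n (laplace N f)) := by
  rw [restrict_laplace hf]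
  refine ((ExponentsLE.sum fun i _ => (h.theta i).theta i).add
    ((ExponentsLE.sum fun i _ => ExponentsLE.sum fun j hj => ?_).smul _)).sub
    ((ExponentsLE.sum fun i _ => h.theta i).smul _)
  exact add_mul_dividedTheta hf h (ne_of_mem_erase hj).symm

/-! ### Two variables -/

/-- The exponent vector of `x_1 ^ k x_2 ^ l`. -/
def expPair (k l : ℕ) : Fin 2 →₀ ℕ := Finsupp.single 0 k + Finsupp.single 1 l

@[simp] theorem expPair_zero (k l : ℕ) : expPair k l 0 = k := by simp [expPair]

@[simp] theorem expPair_one (k l : ℕ) : expPair k l 1 = l := by simp [expPair]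

theorem eq_expPair (m : Fin 2 →₀ ℕ) : m = expPair (m 0) (m 1) := by
  ext i
  fin_cases i <;> simp

theorem restrict_two_laplace {N : ℕ} {f : SymFun} (hf : f ∈ powerSumSubalgebra N) :
    (X 0 - X 1) * restrict 2 (laplace N f) =
      X 0 * (theta 0 (theta 0 (restrict 2 f)) + theta 1 (theta 1 (restrict 2 f)) -
        (2 * tau) • (theta 0 (restrict 2 f) + theta 1 (restrict 2 f)) +
        tau • (theta 0 (restrict 2 f) - theta 1 (restrict 2 f))) -
      X 1 * (theta 0 (theta 0 (restrict 2 f)) + theta 1 (theta 1 (restrict 2 f)) -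
        (2 * tau) • (theta 0 (restrict 2 f) + theta 1 (restrict 2 f)) -
        tau • (theta 0 (restrict 2 f) - theta 1 (restrict 2 f))) := by
  have h0 := dividedTheta_mul_sub hf (0 : Fin 2) 1
  have h1 := dividedTheta_mul_sub hf (1 : Fin 2) 0
  have e0 : (univ : Finset (Fin 2)).erase 0 = {1} := by decide
  have e1 : (univ : Finset (Fin 2)).erase 1 = {0} := by decide
  rw [restrict_laplace hf, Fin.sum_univ_two, Fin.sum_univ_two, Fin.sum_univ_two, e0, e1,
    sum_singleton, sum_singleton]
  have h2 : (C (tau / 2) : MvPolynomial (Fin 2) F) * 2 = C tau := by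
    rw [show (2 : MvPolynomial (Fin 2) F) = C 2 from (map_ofNat C 2).symm, ← C_mul]
    congr 1
    field_simp
  simp only [smul_eq_C_mul, map_mul, map_ofNat, Nat.cast_ofNat]
  set A := theta 0 (restrict 2 f)
  set B := theta 1 (restrict 2 f)
  linear_combination (C (tau / 2) * (X 0 + X 1)) * h0 - (C (tau / 2) * (X 0 + X 1)) * h1 +
    (X 0 + X 1) * (A - B) * h2

/-- The coefficients in the two-term recurrence for the Laplace–Beltrami operator. -/
def recCoeff (k l : F) : F := k ^ 2 + l ^ 2 - 2 * tau * (k + l) + tau * (k - l)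

/-- Comparison of the coefficients of `x_1^{k+1} x_2^{l+1}` after clearing the denominator `x_1 -
x_2`. Only two monomials of the restricted function enter. -/
theorem coeff_restrict_two_laplace {N : ℕ} {f : SymFun} (hf : f ∈ powerSumSubalgebra N)
    (k l : ℕ) : (restrict 2 (laplace N f)).coeff (expPair k (l + 1)) -
      (restrict 2 (laplace N f)).coeff (expPair (k + 1) l) =
    recCoeff k (l + 1) * (restrict 2 f).coeff (expPair k (l + 1)) -
      recCoeff l (k + 1) * (restrict 2 f).coeff (expPair (k + 1) l) := by
  have h := congrArg (coeff (expPair (k + 1) (l + 1))) (restrict_two_laplace hf)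
  have e0 : expPair (k + 1) (l + 1) = Finsupp.single 0 1 + expPair k (l + 1) := by
    ext i; fin_cases i <;> simp [expPair, add_comm]
  have e1 : expPair (k + 1) (l + 1) = Finsupp.single 1 1 + expPair (k + 1) l := by
    ext i; fin_cases i <;> simp [expPair, add_comm]
  have c0 (p : MvPolynomial (Fin 2) F) :
      coeff (expPair (k + 1) (l + 1)) (X 0 * p) = coeff (expPair k (l + 1)) p := by
    rw [e0, coeff_X_mul]
  have c1 (p : MvPolynomial (Fin 2) F) :
      coeff (expPair (k + 1) (l + 1)) (X 1 * p) = coeff (expPair (k + 1) l) p := by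
    rw [e1, coeff_X_mul]
  simp only [sub_mul, coeff_sub, c0, c1, coeff_add, coeff_smul, coeff_theta, expPair_zero,
    expPair_one, smul_eq_mul] at h
  rw [h, recCoeff, recCoeff]
  push_cast
  ring

theorem coeff_restrict_two_laplace_zero {N : ℕ} {f : SymFun} (hf : f ∈ powerSumSubalgebra N)
    (k : ℕ) : (restrict 2 (laplace N f)).coeff (expPair k 0) =
    recCoeff k 0 * (restrict 2 f).coeff (expPair k 0) := by
  have h := congrArg (coeff (expPair (k + 1) 0)) (restrict_two_laplace hf)
  have e0 : expPair (k + 1) 0 = Finsupp.single 0 1 + expPair k 0 := by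
    ext i; fin_cases i <;> simp [expPair, add_comm]
  have c0 (p : MvPolynomial (Fin 2) F) :
      coeff (expPair (k + 1) 0) (X 0 * p) = coeff (expPair k 0) p := by
    rw [e0, coeff_X_mul]
  have c1 (p : MvPolynomial (Fin 2) F) : coeff (expPair (k + 1) 0) (X 1 * p) = 0 := by
    rw [coeff_X_mul', if_neg (by simp)]
  simp only [sub_mul, coeff_sub, c0, c1, coeff_add, coeff_smul, coeff_theta, expPair_zero,
    expPair_one, smul_eq_mul] at h
  rw [sub_zero] at h
  rw [h, recCoeff]
  push_cast
  ring

/-- The leading coefficient of the Laplace–Beltrami operator. -/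
theorem coeff_restrict_two_laplace_of_exponentsLE {N : ℕ} {f : SymFun}
    (hf : f ∈ powerSumSubalgebra N) {k : ℕ} (h : ExponentsLE k (restrict 2 f)) (l : ℕ) :
    (restrict 2 (laplace N f)).coeff (expPair k l) =
      recCoeff k l * (restrict 2 f).coeff (expPair k l) := by
  cases l with
  | zero => rw [coeff_restrict_two_laplace_zero hf]; simp
  | succ l =>
    -- At the largest permitted exponent the neighbouring monomial `x_1^{k+1} x_2^l` is absent both
    -- before and after applying the operator, so the recurrence has one term on each side.
    have hz : ∀ p : MvPolynomial (Fin 2) F, ExponentsLE k p →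
        p.coeff (expPair (k + 1) l) = 0 := by
      intro p hp
      by_contra hc
      have := hp _ (mem_support_iff.mpr hc) 0
      simp at this
    have := coeff_restrict_two_laplace hf k l
    rw [hz _ h, hz _ (h.laplace hf), mul_zero, sub_zero, sub_zero] at this
    rw [this, Nat.cast_succ]

/-! ### Monomial expansions -/

/-- The multiset of the nonzero entries of a tuple. -/
def shape {n : ℕ} (v : Fin n → ℕ) : Multiset ℕ := (univ.val.map v).filter (· ≠ 0)

theorem sum_shape {n : ℕ} (v : Fin n → ℕ) : (shape v).sum = ∑ i, v i := by
  rw [shape]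
  have h := congrArg Multiset.sum (Multiset.filter_add_not (· ≠ 0) (univ.val.map v))
  have h0 : ((univ.val.map v).filter fun a => ¬ a ≠ 0).sum = 0 :=
    Multiset.sum_eq_zero fun a ha => by simpa using (Multiset.mem_filter.mp ha).2
  rw [Multiset.sum_add, h0, add_zero] at h
  rw [h]
  rfl

theorem mem_shape {n : ℕ} {v : Fin n → ℕ} {a : ℕ} (h : a ∈ shape v) : ∃ i, v i = a := by
  simpa using (Multiset.mem_filter.mp h).1

theorem mem_shape_of_ne_zero {n : ℕ} {v : Fin n → ℕ} {i : Fin n} (h : v i ≠ 0) :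
    v i ∈ shape v :=
  Multiset.mem_filter.mpr ⟨Multiset.mem_map.mpr ⟨i, Finset.mem_univ i, rfl⟩, h⟩

theorem parts_ofSym {n d : ℕ} (s : Sym (Fin n) d) :
    (Nat.Partition.ofSym s).parts = shape fun i => s.1.count i := by
  rw [shape, Multiset.filter_map]
  change s.1.dedup.map s.1.count = _
  congr 1
  have : univ.filter (fun i => s.1.count i ≠ 0) = s.1.toFinset := by
    ext i
    simp
  rw [← Multiset.toFinset_val, ← this]
  rfl

theorem coeff_msymm {n d : ℕ} (mu : d.Partition) (m : Fin n →₀ ℕ) :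
    (msymm (Fin n) F mu).coeff m = if shape m = mu.parts then 1 else 0 := by
  have hX : ∀ s : Sym (Fin n) d, (s.1.map (X : Fin n → MvPolynomial (Fin n) F)).prod =
      monomial (Multiset.toFinsupp s.1) 1 := by
    intro s
    rw [monomial_eq, C_1, one_mul, Finsupp.prod, Finset.prod_multiset_map_count]
    rfl
  have hc : ∀ s : Sym (Fin n) d, ((Multiset.toFinsupp s.1 : Fin n →₀ ℕ) : Fin n → ℕ) =
      fun i => s.1.count i := fun s => rfl
  rw [msymm, coeff_sum]
  simp only [hX, coeff_monomial]
  split_ifs with h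
  · have hcard : (Finsupp.toMultiset m).card = d := by
      rw [Finsupp.card_toMultiset, Finsupp.sum_fintype _ _ (by simp), ← mu.parts_sum, ← h,
        sum_shape]
      rfl
    have hm : Multiset.toFinsupp (Finsupp.toMultiset m) = m := Finsupp.toMultiset_toFinsupp m
    obtain ⟨s₀, hs₀⟩ : ∃ s : Sym (Fin n) d, s.1 = Finsupp.toMultiset m :=
      ⟨Sym.mk _ hcard, rfl⟩
    have hs : Nat.Partition.ofSym s₀ = mu := by
      apply Nat.Partition.ext
      rw [parts_ofSym, ← hc, hs₀, hm, h]
    rw [Finset.sum_eq_single ⟨s₀, hs⟩]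
    · rw [if_pos (by rw [hs₀, hm])]
    · rintro ⟨s, hs2⟩ _ hne
      refine if_neg fun hsm => hne (Subtype.ext (Subtype.ext ?_))
      rw [hs₀, ← hsm, Multiset.toFinsupp_toMultiset]
    · intro h
      exact absurd (mem_univ _) h
  · refine sum_eq_zero ?_
    rintro ⟨s, hs⟩ _
    refine if_neg fun hsm => h ?_
    rw [← hs, parts_ofSym, ← hsm]
    rfl

theorem restrict_isSymmetric (n : ℕ) (f : SymFun) : (restrict n f).IsSymmetric := by
  intro e
  rw [restrict, ← AlgHom.comp_apply, comp_aeval]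
  congr 2
  funext k
  exact psum_isSymmetric _ _ _ e

theorem coeff_comp_perm {n : ℕ} {p : MvPolynomial (Fin n) F} (hp : p.IsSymmetric)
    {u v : Fin n →₀ ℕ} (σ : Equiv.Perm (Fin n)) (h : ∀ i, u (σ i) = v i) :
    p.coeff u = p.coeff v := by
  have h1 : v.mapDomain σ = u := by
    ext i
    obtain ⟨j, rfl⟩ := σ.surjective i
    rw [Finsupp.mapDomain_apply σ.injective, h]
  rw [← h1, ← coeff_rename_mapDomain σ σ.injective p v, hp σ]

theorem exists_perm_of_map_eq {n : ℕ} {u v : Fin n → ℕ}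
    (h : univ.val.map u = univ.val.map v) : ∃ σ : Equiv.Perm (Fin n), ∀ i, u (σ i) = v i := by
  have hs : u ∘ Tuple.sort u = v ∘ Tuple.sort v := by
    have hu := Tuple.monotone_sort u
    have hv := Tuple.monotone_sort v
    have hp : (List.ofFn (u ∘ Tuple.sort u)).Perm (List.ofFn (v ∘ Tuple.sort v)) := by
      refine ((Equiv.Perm.ofFn_comp_perm _ u).trans ?_).trans
        (Equiv.Perm.ofFn_comp_perm _ v).symm
      rw [← Multiset.coe_eq_coe]
      simpa [Fin.univ_val_map] using h
    exact List.ofFn_injective (List.Perm.eq_of_sortedLE (List.sortedLE_ofFn_iff.mpr hu)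
      (List.sortedLE_ofFn_iff.mpr hv) hp)
  refine ⟨(Tuple.sort v).symm.trans (Tuple.sort u), fun i => ?_⟩
  have := congrFun hs ((Tuple.sort v).symm i)
  simpa using this

theorem restrict_killCompl {n N : ℕ} (g : Fin n → Fin N) (hg : Function.Injective g)
    (f : SymFun) : killCompl hg (restrict N f) = restrict n f := by
  rw [restrict, ← AlgHom.comp_apply, comp_aeval, restrict]
  congr 2
  funext k
  classical
  simp only [psum, map_sum, map_pow]
  have h : ∀ j : Fin N, j ∉ univ.image g →
      (killCompl hg (X j : MvPolynomial (Fin N) F)) ^ (k : ℕ) = 0 := by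
    intro j hj
    rw [killCompl, aeval_X, dif_neg (by simpa using hj), zero_pow k.pos.ne']
  rw [← sum_subset (subset_univ (univ.image g)) fun j _ => h j, sum_image hg.injOn]
  refine sum_congr rfl fun i _ => ?_
  rw [← rename_X g, killCompl_rename_app]

theorem map_castLE_extend {n N : ℕ} (h : n ≤ N) (u : Fin n →₀ ℕ) :
    univ.val.map (u.mapDomain (Fin.castLE h)) =
      shape u + Multiset.replicate (N - (shape u).card) 0 := by
  have h1 : (univ.val.map (u.mapDomain (Fin.castLE h))).filter (· ≠ 0) = shape u := by
    rw [shape, Multiset.filter_map, Multiset.filter_map]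
    have h2 : univ.filter (fun j => u.mapDomain (Fin.castLE h) j ≠ 0) =
        (univ.filter fun i => u i ≠ 0).map (Fin.castLEEmb h) := by
      ext j
      simp only [mem_filter, mem_univ, true_and, mem_map]
      constructor
      · intro hj
        have : j ∈ Set.range (Fin.castLE h) := by
          by_contra hc
          exact hj (Finsupp.mapDomain_of_notMem_range _ _ hc)
        obtain ⟨i, rfl⟩ := this
        rw [Finsupp.mapDomain_apply (Fin.castLE_injective h)] at hj
        exact ⟨i, hj, rfl⟩
      · rintro ⟨i, hi, rfl⟩
        change u.mapDomain (Fin.castLE h) (Fin.castLE h i) ≠ 0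
        rwa [Finsupp.mapDomain_apply (Fin.castLE_injective h)]
    have h3 := congrArg (fun s : Finset (Fin N) =>
      s.val.map (u.mapDomain (Fin.castLE h))) h2
    simp only [Finset.map_val, Multiset.map_map] at h3
    refine h3.trans (Multiset.map_congr rfl fun i _ => ?_)
    exact Finsupp.mapDomain_apply (Fin.castLE_injective h) u i
  have h4 := Multiset.filter_add_not (· ≠ 0) (univ.val.map (u.mapDomain (Fin.castLE h)))
  rw [h1] at h4
  have h5 : (univ.val.map (u.mapDomain (Fin.castLE h))).filter (fun a => ¬ a ≠ 0) =
      Multiset.replicate (N - (shape u).card) 0 := by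
    rw [Multiset.eq_replicate]
    refine ⟨?_, fun a ha => by simpa using (Multiset.mem_filter.mp ha).2⟩
    have := congrArg Multiset.card h4
    rw [Multiset.card_add, Multiset.card_map] at this
    simp only [card_val, Finset.card_univ, Fintype.card_fin] at this
    omega
  rw [h5] at h4
  exact h4.symm

/-- The coefficient of a monomial in a symmetric function depends only on its exponents. -/
theorem coeff_restrict_eq_of_shape {n n' : ℕ} (f : SymFun) {u : Fin n →₀ ℕ} {v : Fin n' →₀ ℕ}
    (h : shape u = shape v) : (restrict n f).coeff u = (restrict n' f).coeff v := by
  have hn := le_max_left n n'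
  have hn' := le_max_right n n'
  -- Both sides are read off in `max n n'` variables, of which the superfluous ones are set to zero.
  -- There the two exponent vectors differ by a permutation.
  rw [← restrict_killCompl _ (Fin.castLE_injective hn) f,
    ← restrict_killCompl _ (Fin.castLE_injective hn') f, coeff_killCompl, coeff_killCompl]
  have h1 := map_castLE_extend hn u
  rw [h, ← map_castLE_extend hn' v] at h1
  obtain ⟨σ, hσ⟩ := exists_perm_of_map_eq h1
  exact coeff_comp_perm (restrict_isSymmetric _ f) σ hσ

theorem map_toTuple {d : ℕ} (lam : d.Partition) :
    univ.val.map (toTuple lam) =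
      lam.parts + Multiset.replicate (d - lam.parts.card) 0 := by
  have hc : lam.parts.card ≤ d := by
    have := Multiset.card_nsmul_le_sum (s := lam.parts) (a := 1) fun x hx => lam.parts_pos hx
    rw [lam.parts_sum] at this
    simpa using this
  rw [Fin.univ_val_map]
  trans ((lam.parts.sort (· ≥ ·) ++ List.replicate (d - lam.parts.card) 0 : List ℕ) :
    Multiset ℕ)
  swap
  · rw [← Multiset.coe_add, Multiset.sort_eq, Multiset.coe_replicate]
  congr 1
  apply List.ext_getElem
  · simp [hc]
  · intro i h1 h2
    rw [List.getElem_ofFn, toTuple, List.getElem_append]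
    split_ifs with h
    · rw [List.getD_eq_getElem _ _ h]
    · rw [List.getD_eq_default _ _ (not_lt.mp h)]
      simp

theorem shape_toTuple {d : ℕ} (lam : d.Partition) : shape (toTuple lam) = lam.parts := by
  rw [shape, map_toTuple, Multiset.filter_add, Multiset.filter_eq_self.mpr,
    Multiset.filter_eq_nil.mpr]
  · simp
  · intro a ha
    simp [Multiset.eq_of_mem_replicate ha]
  · intro a ha
    exact (lam.parts_pos ha).ne'

/-! ### Dominance below a partition with at most two parts -/

theorem toTuple_antitone {d : ℕ} (lam : d.Partition) : Antitone (toTuple lam) := by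
  intro i j hij
  rw [toTuple, toTuple]
  rcases lt_or_ge (j : ℕ) (lam.parts.sort (· ≥ ·)).length with h | h
  · have hi : (i : ℕ) < (lam.parts.sort (· ≥ ·)).length := lt_of_le_of_lt hij h
    rw [List.getD_eq_getElem _ _ h, List.getD_eq_getElem _ _ hi]
    rcases (Fin.le_def.mp hij).lt_or_eq with h1 | h1
    · exact List.pairwise_iff_getElem.mp (Multiset.pairwise_sort lam.parts (· ≥ ·)) _ _ hi h h1
    · simp [h1]
  · rw [List.getD_eq_default _ _ h]
    exact Nat.zero_le _

theorem sum_toTuple {d : ℕ} (lam : d.Partition) : ∑ i, toTuple lam i = d := by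
  rw [← sum_shape, shape_toTuple, lam.parts_sum]

theorem snd_le_fst (lam : P 2) : lam.1 1 ≤ lam.1 0 := lam.2 (by decide)

theorem parts_toPartition {n : ℕ} (lam : P n) : (toPartition lam).parts = shape lam.1 := rfl

theorem sort_coe_of_pairwise {l : List ℕ} (h : l.Pairwise (· ≥ ·)) :
    Multiset.sort (l : Multiset ℕ) (· ≥ ·) = l := by
  refine List.Perm.eq_of_pairwise' (Multiset.pairwise_sort _ _) h ?_
  rw [← Multiset.coe_eq_coe, Multiset.sort_eq]

theorem toTuple_toPartition (lam : P 2) (i : Fin (∑ i, lam.1 i)) :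
    toTuple (toPartition lam) i = [lam.1 0, lam.1 1].getD i 0 := by
  have h := snd_le_fst lam
  rw [toTuple, parts_toPartition, shape, Fin.univ_val_map, List.ofFn_succ, List.ofFn_succ,
    List.ofFn_zero]
  have e : Fin.succ (0 : Fin 1) = (1 : Fin 2) := rfl
  rw [e]
  generalize hr : lam.1 0 = r at *
  generalize hq : lam.1 1 = q at *
  generalize (i : ℕ) = k
  rw [Multiset.filter_coe, sort_coe_of_pairwise]
  · rcases k with _ | _ | k <;> by_cases h1 : r = 0 <;> by_cases h2 : q = 0 <;>
      simp_all
  · exact List.Pairwise.filter _ (by simpa using h)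

/-- From the second partial sum on, `λ` has already reached its total, so only the first inequality
`μ_1 ≤ λ_1` has content. This is where length at most two is essential. -/
theorem dominates_toPartition_iff (lam : P 2) (mu : (∑ i, lam.1 i).Partition) :
    Dominates (toPartition lam) mu ↔ ∀ a ∈ mu.parts, a ≤ lam.1 0 := by
  have hle := snd_le_fst lam
  constructor
  · intro h a ha
    rw [← shape_toTuple] at ha
    obtain ⟨i, rfl⟩ := mem_shape ha
    have h0 : 0 < ∑ i, lam.1 i := i.pos
    have h1 := h.1 ⟨0, h0⟩
    have e : Finset.Iic (⟨0, h0⟩ : Fin (∑ i, lam.1 i)) = {⟨0, h0⟩} := by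
      ext j
      simp [Fin.le_def, Fin.ext_iff]
    rw [e, sum_singleton, sum_singleton, toTuple_toPartition] at h1
    refine le_trans (toTuple_antitone mu (a := ⟨0, h0⟩) (Nat.zero_le _)) h1
  · intro h
    have hmu : ∀ i, toTuple mu i ≤ lam.1 0 := by
      intro i
      rcases eq_or_ne (toTuple mu i) 0 with h0 | h0
      · rw [h0]
        exact Nat.zero_le _
      · refine h _ ?_
        rw [← shape_toTuple]
        exact mem_shape_of_ne_zero h0
    refine ⟨fun k => ?_, by rw [sum_toTuple, sum_toTuple]⟩
    obtain ⟨k, hk⟩ := k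
    rcases k with _ | k
    · have e : Finset.Iic (⟨0, hk⟩ : Fin (∑ i, lam.1 i)) = {⟨0, hk⟩} := by
        ext j
        simp [Fin.le_def, Fin.ext_iff]
      rw [e, sum_singleton, sum_singleton, toTuple_toPartition]
      exact hmu _
    · calc ∑ i ∈ Finset.Iic _, toTuple mu i ≤ ∑ i, toTuple mu i :=
            sum_le_sum_of_subset (subset_univ _)
        _ = lam.1 0 + lam.1 1 := by rw [sum_toTuple, Fin.sum_univ_two]
        _ = ∑ i ∈ {⟨0, by omega⟩, ⟨1, by omega⟩}, toTuple (toPartition lam) i := by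
            rw [sum_pair (by simp), toTuple_toPartition, toTuple_toPartition]
            rfl
        _ ≤ ∑ i ∈ Finset.Iic _, toTuple (toPartition lam) i := by
            refine sum_le_sum_of_subset fun i hi => ?_
            rw [mem_insert, mem_singleton] at hi
            rw [Finset.mem_Iic, Fin.le_def]
            rcases hi with rfl | rfl <;> simp

theorem coeff_sum_theta {n : ℕ} (p : MvPolynomial (Fin n) F) (m : Fin n →₀ ℕ) :
    (∑ i, theta i p).coeff m = ((∑ i, m i : ℕ) : F) * p.coeff m := by
  simp only [coeff_sum, coeff_theta, ← sum_mul, Nat.cast_sum]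

theorem sum_eq_of_coeff_ne_zero {n d : ℕ} {p : MvPolynomial (Fin n) F}
    (h : ∑ i, theta i p = (d : F) • p) {m : Fin n →₀ ℕ} (hm : p.coeff m ≠ 0) :
    ∑ i, m i = d := by
  have h1 := congrArg (coeff m) h
  rw [coeff_sum_theta, coeff_smul, smul_eq_mul] at h1
  exact_mod_cast mul_right_cancel₀ hm h1

theorem sum_theta_eq_smul {n d : ℕ} {p : MvPolynomial (Fin n) F}
    (h : ∀ m, p.coeff m ≠ 0 → ∑ i, m i = d) : ∑ i, theta i p = (d : F) • p := by
  ext m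
  rw [coeff_sum_theta, coeff_smul, smul_eq_mul]
  by_cases hm : p.coeff m = 0
  · rw [hm, mul_zero, mul_zero]
  · rw [h m hm]

/-- The symmetric functions, homogeneous of degree `|λ|`, whose exponents are at most `λ_1`: the
span of the `m_μ` with `μ` below `λ`. -/
def below (lam : P 2) : Submodule F SymFun where
  carrier := {f | ∀ n, ∑ i, theta i (restrict n f) = ((∑ i, lam.1 i : ℕ) : F) • restrict n f ∧
    ExponentsLE (lam.1 0) (restrict n f)}
  zero_mem' := fun n => by
    rw [map_zero]
    exact ⟨by simp [theta], ExponentsLE.zero _⟩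
  add_mem' := fun {f g} hf hg n => by
    refine ⟨?_, by rw [map_add]; exact (hf n).2.add (hg n).2⟩
    simp only [map_add, theta_add, sum_add_distrib, (hf n).1, (hg n).1, smul_add]
  smul_mem' := fun a f hf n => by
    refine ⟨?_, by rw [map_smul]; exact (hf n).2.smul a⟩
    simp only [map_smul, theta_smul, ← smul_sum, (hf n).1]
    rw [smul_comm]

/-- The coefficient of `m_λ`. -/
def leadCoeff (lam : P 2) (f : SymFun) : F :=
  (restrict 2 f).coeff (expPair (lam.1 0) (lam.1 1))

theorem shape_expPair (lam : P 2) :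
    shape (expPair (lam.1 0) (lam.1 1)) = (toPartition lam).parts := by
  rw [parts_toPartition]
  congr 1
  ext i
  fin_cases i <;> simp

theorem HasMonomialExpansion.coeff_eq {d n : ℕ} {f : SymFun} {K : d.Partition → F}
    (h : HasMonomialExpansion f K) {m : Fin n →₀ ℕ} {mu : d.Partition}
    (hm : shape m = mu.parts) : (restrict n f).coeff m = K mu := by
  rw [h n, coeff_sum, Finset.sum_eq_single mu]
  · rw [coeff_smul, coeff_msymm, if_pos hm, smul_eq_mul, mul_one]
  · intro nu _ hne
    rw [coeff_smul, coeff_msymm, if_neg, smul_zero]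
    intro h
    exact hne (Nat.Partition.ext (h.symm.trans hm))
  · simp

theorem HasMonomialExpansion.exists_of_coeff_ne_zero {d n : ℕ} {f : SymFun}
    {K : d.Partition → F} (h : HasMonomialExpansion f K) {m : Fin n →₀ ℕ}
    (hm : (restrict n f).coeff m ≠ 0) : ∃ mu : d.Partition, shape m = mu.parts ∧ K mu ≠ 0 := by
  have h1 := hm
  rw [h n, coeff_sum] at h1
  obtain ⟨mu, _, hmu⟩ := exists_ne_zero_of_sum_ne_zero h1
  have hs : shape m = mu.parts := by
    by_contra hs
    rw [coeff_smul, coeff_msymm, if_neg hs, smul_zero] at hmu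
    exact hmu rfl
  exact ⟨mu, hs, by rwa [← h.coeff_eq hs]⟩

theorem HasMonomialExpansion.mem_below {lam : P 2} {f : SymFun}
    {K : (∑ i, lam.1 i).Partition → F} (h : HasMonomialExpansion f K)
    (hK : ∀ mu, K mu ≠ 0 → Dominates (toPartition lam) mu) : f ∈ below lam := by
  intro n
  refine ⟨sum_theta_eq_smul fun m hm => ?_, fun m hm i => ?_⟩
  · obtain ⟨mu, hmu, _⟩ := h.exists_of_coeff_ne_zero hm
    rw [← sum_shape, hmu, mu.parts_sum]
  · obtain ⟨mu, hmu, h0⟩ := h.exists_of_coeff_ne_zero (mem_support_iff.mp hm)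
    rcases eq_or_ne (m i) 0 with hi | hi
    · rw [hi]
      exact Nat.zero_le _
    · refine (dominates_toPartition_iff lam mu).mp (hK mu h0) _ ?_
      rw [← hmu]
      exact mem_shape_of_ne_zero hi

theorem HasMonomialExpansion.leadCoeff_eq {lam : P 2} {f : SymFun}
    {K : (∑ i, lam.1 i).Partition → F} (h : HasMonomialExpansion f K) :
    leadCoeff lam f = K (toPartition lam) :=
  h.coeff_eq (shape_expPair lam)

/-- Every partition of `|λ|` fits into `|λ|` variables, so the coefficients can be read off there;
they are the same in any other number of variables. -/
theorem exists_hasMonomialExpansion {lam : P 2} {f : SymFun} (hf : f ∈ below lam) :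
    ∃ K : (∑ i, lam.1 i).Partition → F, HasMonomialExpansion f K ∧
      ∀ mu, K mu ≠ 0 → Dominates (toPartition lam) mu := by
  set e : (∑ i, lam.1 i).Partition → (Fin (∑ i, lam.1 i) →₀ ℕ) :=
    fun mu => Finsupp.equivFunOnFinite.symm (toTuple mu) with he
  have hs : ∀ mu, shape (e mu) = mu.parts := fun mu => by
    rw [he, Finsupp.coe_equivFunOnFinite_symm, shape_toTuple]
  refine ⟨fun mu => (restrict _ f).coeff (e mu), fun n => ?_, fun mu hmu => ?_⟩
  · ext m
    simp only [coeff_sum, coeff_smul, coeff_msymm, smul_eq_mul, mul_ite, mul_one, mul_zero]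
    by_cases hd : ∑ i, m i = ∑ i, lam.1 i
    · obtain ⟨mu, hmu⟩ : ∃ mu : (∑ i, lam.1 i).Partition, shape m = mu.parts :=
        ⟨Nat.Partition.ofSums _ (univ.val.map m) hd, rfl⟩
      rw [Finset.sum_eq_single mu]
      · rw [if_pos hmu]
        exact coeff_restrict_eq_of_shape f (hmu.trans (hs mu).symm)
      · intro nu _ hne
        exact if_neg fun h => hne (Nat.Partition.ext (h.symm.trans hmu))
      · simp
    · rw [sum_eq_zero]
      · by_contra hc
        exact hd (sum_eq_of_coeff_ne_zero (hf n).1 hc)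
      · intro mu _
        refine if_neg fun h => hd ?_
        rw [← sum_shape, h, mu.parts_sum]
  · rw [dominates_toPartition_iff]
    intro a ha
    rw [← hs] at ha
    obtain ⟨i, rfl⟩ := mem_shape ha
    exact (hf _).2 _ (mem_support_iff.mpr hmu) i

/-- The span of the `m_μ` with `μ` strictly below `λ`. -/
def strictlyBelow (lam : P 2) : Submodule F SymFun where
  carrier := {f | f ∈ below lam ∧ leadCoeff lam f = 0}
  zero_mem' := ⟨zero_mem _, by simp [leadCoeff]⟩
  add_mem' := fun {f g} hf hg => ⟨add_mem hf.1 hg.1, by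
    have h1 := hf.2
    have h2 := hg.2
    rw [leadCoeff] at h1 h2 ⊢
    rw [map_add, coeff_add, h1, h2, add_zero]⟩
  smul_mem' := fun a f hf => ⟨Submodule.smul_mem _ _ hf.1, by
    have h1 := hf.2
    rw [leadCoeff] at h1 ⊢
    rw [map_smul, coeff_smul, h1, smul_zero]⟩

/-- Replaces dominance and monomial expansions by conditions on degree and exponents, which are the
ones the operator visibly preserves. -/
theorem isJack_iff (lam : P 2) (f : SymFun) : IsJack (toPartition lam) f ↔
    f ∈ below lam ∧ leadCoeff lam f = 1 ∧ ∀ g ∈ strictlyBelow lam, hall f g = 0 := by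
  constructor
  · rintro ⟨⟨K, hK, h1, hd⟩, ho⟩
    refine ⟨hK.mem_below hd, hK.leadCoeff_eq.trans h1, fun g hg => ?_⟩
    obtain ⟨K', hK', hd'⟩ := exists_hasMonomialExpansion hg.1
    refine ho g K' hK' fun mu hmu => ⟨hd' mu hmu, ?_⟩
    rintro rfl
    exact hmu (hK'.leadCoeff_eq.symm.trans hg.2)
  · rintro ⟨hf, h1, ho⟩
    obtain ⟨K, hK, hd⟩ := exists_hasMonomialExpansion hf
    refine ⟨⟨K, hK, hK.leadCoeff_eq.symm.trans h1, hd⟩, fun g K' hK' hd' => ho g ⟨?_, ?_⟩⟩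
    · exact hK'.mem_below fun mu hmu => (hd' mu hmu).1
    · rw [hK'.leadCoeff_eq]
      by_contra hc
      exact (hd' _ hc).2 rfl

/-! ### Existence of the Jack symmetric functions -/

/-- The degree of `p_k` is `k`. -/
abbrev powerSumDegree (k : ℕ+) : ℕ := k

theorem sum_theta_mul {n : ℕ} {a b : F} {p q : MvPolynomial (Fin n) F}
    (hp : ∑ i, theta i p = a • p) (hq : ∑ i, theta i q = b • q) :
    ∑ i, theta i (p * q) = (a + b) • (p * q) := by
  simp only [theta_mul, sum_add_distrib, ← sum_mul, ← mul_sum, hp, hq]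
  rw [smul_mul_assoc, mul_smul_comm, ← add_smul]

theorem sum_theta_restrict_monomial (n : ℕ) (m : ℕ+ →₀ ℕ) (a : F) :
    ∑ i, theta i (restrict n (monomial m a)) =
      ((Finsupp.weight powerSumDegree m : ℕ) : F) • restrict n (monomial m a) := by
  have key : ∑ i, theta i (restrict n (monomial m 1)) =
      ((Finsupp.weight powerSumDegree m : ℕ) : F) • restrict n (monomial m 1) := by
    induction m using Finsupp.induction_linear with
    | zero => simp [theta]
    | add f g hf hg =>
      rw [← mul_one (1 : F), ← monomial_mul, map_mul, sum_theta_mul hf hg, map_add,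
        Nat.cast_add]
    | single k e =>
      have hk : ∑ i, theta i (restrict n (X k)) = ((k : ℕ) : F) • restrict n (X k) := by
        have : restrict n (X k) = psum (Fin n) F k := by simp [restrict]
        rw [this]
        simp only [theta_psum]
        rw [← smul_sum, psum]
      induction e with
      | zero => simp [theta]
      | succ e ih =>
        have hX : (monomial (Finsupp.single k 1) 1 : SymFun) = X k := rfl
        rw [Finsupp.single_add, ← mul_one (1 : F), ← monomial_mul, map_mul, hX,
          sum_theta_mul ih hk, map_add, Nat.cast_add]
        simp [Finsupp.weight_single]
  have h : (monomial m a : SymFun) = a • monomial m 1 := by simp [smul_monomial]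
  rw [h, map_smul]
  simp only [theta_smul, ← smul_sum, key]
  rw [smul_comm]

/-- A power-sum product of degree `e` restricts to a homogeneous polynomial of degree `e`, so the
other components cannot contribute in degree `d`. This allows work in a finite-dimensional space
without knowing that the restrictions determine `f`. -/
theorem restrict_weightedHomogeneousComponent {n d : ℕ} {f : SymFun}
    (h : ∑ i, theta i (restrict n f) = (d : F) • restrict n f) :
    restrict n (weightedHomogeneousComponent powerSumDegree d f) = restrict n f := by
  ext u
  have hm : ∀ (m : ℕ+ →₀ ℕ) (a : F), ∑ i, u i ≠ Finsupp.weight powerSumDegree m →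
      (restrict n (monomial m a)).coeff u = 0 := by
    intro m a hu
    by_contra hc
    exact hu (sum_eq_of_coeff_ne_zero (sum_theta_restrict_monomial n m a) hc)
  rw [weightedHomogeneousComponent_apply, map_sum, coeff_sum, sum_filter]
  by_cases hu : ∑ i, u i = d
  · conv_rhs => rw [f.as_sum, map_sum, coeff_sum]
    refine sum_congr rfl fun m _ => ?_
    split_ifs with hd
    · rfl
    · exact (hm m _ fun h => hd (by rw [← h, hu])).symm
  · rw [sum_eq_zero]
    · by_contra hc
      exact hu (sum_eq_of_coeff_ne_zero h (Ne.symm hc))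
    · intro m _
      split_ifs with hd
      · exact hm m _ fun h => hu (by rw [h, hd])
      · rfl

theorem weightedHomogeneousComponent_mem {lam : P 2} {f : SymFun}
    (hf : f ∈ strictlyBelow lam) :
    weightedHomogeneousComponent powerSumDegree (∑ i, lam.1 i) f ∈ strictlyBelow lam := by
  have h : ∀ n, _ := fun n => restrict_weightedHomogeneousComponent (hf.1 n).1
  refine ⟨fun n => ?_, ?_⟩
  · rw [h]
    exact hf.1 n
  · rw [leadCoeff, h]
    exact hf.2

theorem hall_weightedHomogeneousComponent {d : ℕ} {f : SymFun}
    (hf : IsWeightedHomogeneous powerSumDegree f d) (g : SymFun) :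
    hall f (weightedHomogeneousComponent powerSumDegree d g) = hall f g := by
  classical
  refine sum_congr rfl fun m hm => ?_
  rw [coeff_weightedHomogeneousComponent, if_pos (hf (mem_support_iff.mp hm))]

theorem finite_weight_eq (d : ℕ) :
    {m : ℕ+ →₀ ℕ | Finsupp.weight powerSumDegree m = d}.Finite := by
  classical
  refine (Set.finite_Iic (∑ k ∈ range d, Finsupp.single k.succPNat d)).subset fun m hm k => ?_
  change Finsupp.weight powerSumDegree m = d at hm
  rcases eq_or_ne (m k) 0 with h0 | h0
  · rw [h0]
    exact Nat.zero_le _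
  have h1 : m k ≤ d := hm ▸ Finsupp.le_weight powerSumDegree k.ne_zero m
  have h2 : (k : ℕ) ≤ d := hm ▸ Finsupp.le_weight_of_ne_zero' powerSumDegree h0
  rw [Finsupp.finsetSum_apply]
  refine h1.trans ?_
  have h3 : k.natPred ∈ range d := by
    have := k.natPred_add_one
    rw [mem_range]
    omega
  refine le_trans ?_ (single_le_sum (f := fun i => Finsupp.single i.succPNat d k)
    (fun i _ => Nat.zero_le _) h3)
  simp

instance (d : ℕ) : FiniteDimensional F (weightedHomogeneousSubmodule F powerSumDegree d) := by
  have h : weightedHomogeneousSubmodule F powerSumDegree d ≤ Submodule.span F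
      ((fun m => (monomial m 1 : SymFun)) '' {m | Finsupp.weight powerSumDegree m = d}) := by
    intro p hp
    rw [p.as_sum]
    refine Submodule.sum_mem _ fun m hm => ?_
    have : (monomial m (p.coeff m) : SymFun) = p.coeff m • monomial m 1 := by
      simp [smul_monomial]
    rw [this]
    exact Submodule.smul_mem _ _ (Submodule.subset_span ⟨m, hp (mem_support_iff.mp hm), rfl⟩)
  have := FiniteDimensional.span_of_finite F
    ((finite_weight_eq d).image fun m => (monomial m 1 : SymFun))
  exact Submodule.finiteDimensional_of_le h

/-- Orthogonal projection to a finite-dimensional space of symmetric functions. -/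
theorem exists_orthogonal_projection (U : Submodule F SymFun) [FiniteDimensional F U]
    (f : SymFun) : ∃ g ∈ U, ∀ u ∈ U, hall (f - g) u = 0 := by
  set T : U →ₗ[F] Module.Dual F U := (hallForm.domRestrict₁₂ U U) with hT
  have hinj : Function.Injective T := by
    rw [← LinearMap.ker_eq_bot, LinearMap.ker_eq_bot']
    intro u hu
    have h := LinearMap.congr_fun hu u
    rw [hT, LinearMap.domRestrict₁₂_apply, hallForm_eq_hall, LinearMap.zero_apply] at h
    exact Subtype.ext (hall_self_eq_zero h)
  have hsurj := (LinearMap.injective_iff_surjective_of_finrank_eq_finrank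
    Subspace.dual_finrank_eq.symm).mp hinj
  obtain ⟨g, hg⟩ := hsurj ((hallForm f).comp U.subtype)
  refine ⟨g, g.2, fun u hu => ?_⟩
  have h := LinearMap.congr_fun hg ⟨u, hu⟩
  rw [hT, LinearMap.domRestrict₁₂_apply, hallForm_eq_hall, LinearMap.comp_apply,
    hallForm_eq_hall] at h
  rw [hall_sub_left, h]
  exact sub_self _

/-- The symmetric function `e_1 ^ (λ_1 - λ_2) e_2 ^ λ_2`. -/
def elementaryProduct (lam : P 2) : SymFun :=
  X 1 ^ (lam.1 0 - lam.1 1) * (C (1 / 2) * (X 1 ^ 2 - X 2)) ^ lam.1 1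

theorem elementaryProduct_isWeightedHomogeneous (lam : P 2) :
    IsWeightedHomogeneous powerSumDegree (elementaryProduct lam) (∑ i, lam.1 i) := by
  have h1 : IsWeightedHomogeneous powerSumDegree (X 1 : SymFun) 1 :=
    isWeightedHomogeneous_X F powerSumDegree 1
  have h2 : IsWeightedHomogeneous powerSumDegree (X 2 : SymFun) 2 :=
    isWeightedHomogeneous_X F powerSumDegree 2
  have h3 : IsWeightedHomogeneous powerSumDegree (C (1 / 2) * (X 1 ^ 2 - X 2) : SymFun) 2 := by
    have h := (isWeightedHomogeneous_C powerSumDegree (1 / 2 : F)).mul ((h1.pow 2).sub h2)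
    simpa using h
  have h4 := (h1.pow (lam.1 0 - lam.1 1)).mul (h3.pow (lam.1 1))
  have hle := snd_le_fst lam
  have h5 : ∑ i, lam.1 i = (lam.1 0 - lam.1 1) • 1 + lam.1 1 • 2 := by
    rw [Fin.sum_univ_two]
    simp only [smul_eq_mul]
    omega
  rw [h5]
  exact h4

theorem restrict_X_one (n : ℕ) : restrict n (X 1) = ∑ i, X i := by
  simp [restrict, psum]

theorem restrict_X_two (n : ℕ) : restrict n (X 2) = ∑ i, X i ^ 2 := by
  simp [restrict, psum]

/-- Both `e_1` and `e_2 = (p_1^2 - p_2)/2` have degree at most one in each variable, and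
`e_1^{λ_1-λ_2} e_2^{λ_2}` has `λ_1` factors. -/
theorem exponentsLE_elementaryProduct (lam : P 2) (n : ℕ) :
    ExponentsLE (lam.1 0) (restrict n (elementaryProduct lam)) := by
  classical
  have hX : ∀ i j : Fin n, degreeOf i (X j : MvPolynomial (Fin n) F) = if i = j then 1 else 0 :=
    fun i j => degreeOf_X i j
  have h1 : ∀ i, degreeOf i (restrict n (X 1)) ≤ 1 := by
    intro i
    rw [restrict_X_one]
    refine (degreeOf_sum_le _ _ _).trans (Finset.sup_le fun j _ => ?_)
    rw [hX]
    split_ifs <;> simp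
  have h2 : ∀ i, degreeOf i (restrict n (X 1 ^ 2 - X 2)) ≤ 1 := by
    intro i
    have e : restrict n (X 1 ^ 2 - X 2) = ∑ j : Fin n, ∑ k ∈ univ.erase j, X j * X k := by
      rw [map_sub, map_pow, restrict_X_one, restrict_X_two, sq, sum_mul_sum, ← sum_sub_distrib]
      refine sum_congr rfl fun j _ => ?_
      rw [sum_erase_eq_sub (mem_univ j), sq]
    rw [e]
    refine (degreeOf_sum_le _ _ _).trans (Finset.sup_le fun j _ =>
      (degreeOf_sum_le _ _ _).trans (Finset.sup_le fun k hk => ?_))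
    refine (degreeOf_mul_le _ _ _).trans ?_
    rw [hX, hX]
    have := ne_of_mem_erase hk
    split_ifs with h3 h4
    · exact absurd (h4.symm.trans h3) this
    all_goals simp
  refine exponentsLE_of_degreeOf_le fun i => ?_
  have hle := snd_le_fst lam
  rw [elementaryProduct, map_mul, map_pow, map_pow, map_mul]
  have h3 : degreeOf i (restrict n (C (1 / 2)) * restrict n (X 1 ^ 2 - X 2)) ≤ 1 := by
    have : restrict n (C (1 / 2)) = C (1 / 2) := by simp [restrict]
    rw [this]
    exact (degreeOf_C_mul_le _ _ _).trans (h2 i)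
  refine (degreeOf_mul_le _ _ _).trans ?_
  have h4 := (degreeOf_pow_le i (restrict n (X 1)) (lam.1 0 - lam.1 1)).trans
    (Nat.mul_le_mul_left _ (h1 i))
  have h5 := (degreeOf_pow_le i (restrict n (C (1 / 2)) * restrict n (X 1 ^ 2 - X 2))
    (lam.1 1)).trans (Nat.mul_le_mul_left _ h3)
  omega

theorem X_mul_X_pow_eq (q : ℕ) :
    ((X 0 * X 1) ^ q : MvPolynomial (Fin 2) F) = monomial (expPair q q) 1 := by
  rw [mul_pow, X_pow_eq_monomial, X_pow_eq_monomial, monomial_mul, one_mul]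
  rfl

theorem expPair_add (k l k' l' : ℕ) :
    expPair k l + expPair k' l' = expPair (k + k') (l + l') := by
  ext i
  fin_cases i <;> simp

theorem leadCoeff_elementaryProduct (lam : P 2) : leadCoeff lam (elementaryProduct lam) = 1 := by
  have hle := snd_le_fst lam
  have h1 : restrict 2 (elementaryProduct lam) =
      (X 0 * X 1) ^ lam.1 1 * (X 0 + X 1) ^ (lam.1 0 - lam.1 1) := by
    have e1 : restrict 2 (X 1) = X 0 + X 1 := by rw [restrict_X_one, Fin.sum_univ_two]
    have e2 : restrict 2 (C (1 / 2) * (X 1 ^ 2 - X 2)) = X 0 * X 1 := by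
      have e3 : restrict 2 (C (1 / 2)) = C (1 / 2) := by simp [restrict]
      have e4 : (C (1 / 2) * 2 : MvPolynomial (Fin 2) F) = 1 := by
        rw [show (2 : MvPolynomial (Fin 2) F) = C 2 from (map_ofNat C 2).symm, ← C_mul]
        simp
      rw [map_mul, map_sub, map_pow, e1, restrict_X_two, Fin.sum_univ_two, e3]
      linear_combination (X 0 * X 1 : MvPolynomial (Fin 2) F) * e4
    rw [elementaryProduct, map_mul, map_pow, map_pow, e1, e2, mul_comm]
  have h2 : ∀ k : ℕ, ((X 0 + X 1) ^ k : MvPolynomial (Fin 2) F).coeff (expPair k 0) = 1 := by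
    intro k
    induction k with
    | zero => simp [expPair]
    | succ k ih =>
      have e0 : expPair (k + 1) 0 = Finsupp.single 0 1 + expPair k 0 := by
        ext i; fin_cases i <;> simp [expPair, add_comm]
      rw [pow_succ', add_mul, coeff_add, coeff_X_mul' _ (1 : Fin 2), if_neg (by simp), e0,
        coeff_X_mul, ih, add_zero]
  have e : expPair (lam.1 0) (lam.1 1) =
      expPair (lam.1 1) (lam.1 1) + expPair (lam.1 0 - lam.1 1) 0 := by
    rw [expPair_add, add_zero]
    congr 1
    omega
  rw [leadCoeff, h1, X_mul_X_pow_eq, e, coeff_monomial_mul, h2, one_mul]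

/-- One Gram–Schmidt step: from a function with leading term `m_λ`, subtract its orthogonal
projection to the strictly lower span. Anisotropy makes the projection exist in the homogeneous part
of that span. -/
theorem exists_isJack (lam : P 2) : ∃ f, IsJack (toPartition lam) f := by
  set d := ∑ i, lam.1 i
  set W := weightedHomogeneousSubmodule F powerSumDegree d
  have hf0 : elementaryProduct lam ∈ W := elementaryProduct_isWeightedHomogeneous lam
  have hE : ∀ f ∈ W, ∀ n, ∑ i, theta i (restrict n f) = (d : F) • restrict n f := by
    intro f hf n
    rw [f.as_sum, map_sum, smul_sum]
    simp only [theta_sum]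
    rw [sum_comm]
    refine sum_congr rfl fun m hm => ?_
    rw [sum_theta_restrict_monomial, hf (mem_support_iff.mp hm)]
  have : FiniteDimensional F (strictlyBelow lam ⊓ W : Submodule F SymFun) :=
    Submodule.finiteDimensional_inf_right _ _
  obtain ⟨g, hg, hU⟩ := exists_orthogonal_projection (strictlyBelow lam ⊓ W)
    (elementaryProduct lam)
  refine ⟨elementaryProduct lam - g, (isJack_iff _ _).mpr ⟨?_, ?_, fun u hu => ?_⟩⟩
  · exact sub_mem (fun n => ⟨hE _ hf0 n, exponentsLE_elementaryProduct lam n⟩) hg.1.1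
  · have h1 := hg.1.2
    have h2 := leadCoeff_elementaryProduct lam
    rw [leadCoeff] at h1 h2 ⊢
    rw [map_sub, coeff_sub, h1, h2, sub_zero]
  -- The difference is homogeneous of degree `d`, so an arbitrary test function `u` may be replaced
  -- by its component of degree `d`.
  · rw [← hall_weightedHomogeneousComponent (sub_mem hf0 hg.2 : _ ∈ W) u]
    exact hU _ ⟨weightedHomogeneousComponent_mem hu,
      weightedHomogeneousComponent_isWeightedHomogeneous _ _⟩

/-! ### The Laplace–Beltrami operator on Jack symmetric functions -/

theorem laplace_eq_of_le {N N' : ℕ} (h : N ≤ N') {f : SymFun}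
    (hf : f ∈ powerSumSubalgebra N) : laplace N' f = laplace N f := by
  have hsub : range N ⊆ range N' := range_subset_range.mpr h
  have hz : ∀ k, k ∉ range N → pderiv k.succPNat f = 0 := fun k hk =>
    pderiv_eq_zero_of_mem hf (by simpa using hk)
  have h0 : ∀ k l : ℕ, (k ∉ range N ∨ l ∉ range N) →
      ((k + 1) * (l + 1) : F) • (X (k.succPNat + l.succPNat) *
        pderiv k.succPNat (pderiv l.succPNat f)) +
      (tau * (k + l + 2) : F) • (X k.succPNat * (X l.succPNat *
        pderiv (k.succPNat + l.succPNat) f)) = 0 := by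
    intro k l hkl
    have h1 : pderiv k.succPNat (pderiv l.succPNat f) = 0 := by
      rcases hkl with hk | hl
      · rw [pderiv_pderiv_comm, hz k hk, map_zero]
      · rw [hz l hl, map_zero]
    have h2 : pderiv (k.succPNat + l.succPNat) f = 0 := by
      rw [succPNat_add]
      refine hz _ ?_
      simp only [mem_range] at hkl ⊢
      omega
    rw [h1, h2]
    simp
  rw [laplace, laplace]
  congr 1
  · rw [← sum_subset hsub fun k _ hk => sum_eq_zero fun l _ => h0 k l (Or.inl hk)]
    refine sum_congr rfl fun k _ => ?_
    rw [← sum_subset hsub fun l _ hl => h0 k l (Or.inr hl)]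
  · rw [← sum_subset hsub fun k _ hk => by rw [hz k hk]; simp]

/-- Homogeneity is expressed by Euler's equation. The operators `θ_i` commute with the Euler
operator, and the divided difference has degree `a - 1`, restored by the factor `x_i + x_j`. -/
theorem sum_theta_restrict_laplace {N n : ℕ} {a : F} {f : SymFun}
    (hf : f ∈ powerSumSubalgebra N) (h : ∑ i, theta i (restrict n f) = a • restrict n f) :
    ∑ i, theta i (restrict n (laplace N f)) = a • restrict n (laplace N f) := by
  have hcomm : ∀ (i j : Fin n) (p : MvPolynomial (Fin n) F),
      theta i (theta j p) = theta j (theta i p) := by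
    intro i j p
    ext m
    rw [coeff_theta, coeff_theta, coeff_theta, coeff_theta]
    ring
  have hth : ∀ (j : Fin n) {p : MvPolynomial (Fin n) F}, ∑ i, theta i p = a • p →
      ∑ i, theta i (theta j p) = a • theta j p := by
    intro j p hp
    rw [← theta_smul, ← hp, theta_sum]
    exact sum_congr rfl fun i _ => hcomm i j p
  have hadd : ∀ {p q : MvPolynomial (Fin n) F}, ∑ i, theta i p = a • p →
      ∑ i, theta i q = a • q → ∑ i, theta i (p + q) = a • (p + q) := by
    intro p q hp hq
    simp only [theta_add, sum_add_distrib, hp, hq, smul_add]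
  have hsmul : ∀ (b : F) {p : MvPolynomial (Fin n) F}, ∑ i, theta i p = a • p →
      ∑ i, theta i (b • p) = a • (b • p) := by
    intro b p hp
    simp only [theta_smul, ← smul_sum, hp]
    rw [smul_comm]
  have hsub : ∀ {p q : MvPolynomial (Fin n) F}, ∑ i, theta i p = a • p →
      ∑ i, theta i q = a • q → ∑ i, theta i (p - q) = a • (p - q) := by
    intro p q hp hq
    have := hadd hp (hsmul (-1) hq)
    rwa [neg_one_smul, ← sub_eq_add_neg] at this
  have hsum : ∀ {ι : Type} (s : Finset ι) {p : ι → MvPolynomial (Fin n) F},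
      (∀ k ∈ s, ∑ i, theta i (p k) = a • p k) →
      ∑ i, theta i (∑ k ∈ s, p k) = a • ∑ k ∈ s, p k := by
    intro ι s p hp
    simp only [theta_sum]
    rw [sum_comm, smul_sum]
    exact sum_congr rfl hp
  have hX : ∀ i : Fin n, ∑ j, theta j (X i : MvPolynomial (Fin n) F) = (1 : F) • X i := by
    intro i
    rw [Finset.sum_eq_single i]
    · simp [theta]
    · intro j _ hj
      rw [theta, pderiv_X_of_ne hj.symm, mul_zero]
    · simp
  have hXX : ∀ i j : Fin n, ∑ l, theta l (X i + X j : MvPolynomial (Fin n) F) =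
      (1 : F) • (X i + X j) := by
    intro i j
    simp only [theta_add, sum_add_distrib, hX, smul_add]
  have hdiv : ∀ i j : Fin n, i ≠ j →
      ∑ l, theta l (dividedTheta N f i j) = (a - 1) • dividedTheta N f i j := by
    intro i j hij
    have h1 := hsub (hth i h) (hth j h)
    rw [← dividedTheta_mul_sub hf] at h1
    have h2 : ∑ l, theta l (X i - X j : MvPolynomial (Fin n) F) = (1 : F) • (X i - X j) := by
      simp only [sub_eq_add_neg (X i : MvPolynomial (Fin n) F),
        ← neg_one_smul F (X j : MvPolynomial (Fin n) F), theta_add,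
        theta_smul, sum_add_distrib, ← smul_sum, hX, smul_add, one_smul]
    simp only [theta_mul, sum_add_distrib, ← sum_mul, ← mul_sum, h2] at h1
    have h3 : (X i - X j : MvPolynomial (Fin n) F) ≠ 0 :=
      sub_ne_zero.mpr fun h => hij (X_injective h)
    refine mul_right_cancel₀ h3 ?_
    rw [sub_smul, sub_mul, smul_mul_assoc, ← h1, one_smul, one_smul, add_sub_cancel_right]
  rw [restrict_laplace hf]
  refine hsub (hadd (hsum _ fun i _ => hth i (hth i h)) (hsmul _ (hsum _ fun i _ =>
    hsum _ fun j hj => ?_))) (hsmul _ (hsum _ fun i _ => hth i h))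
  have := sum_theta_mul (hXX i j) (hdiv i j (ne_of_mem_erase hj).symm)
  rwa [add_sub_cancel] at this

theorem laplace_mem_below {lam : P 2} {N : ℕ} {f : SymFun} (hN : f ∈ powerSumSubalgebra N)
    (hf : f ∈ below lam) : laplace N f ∈ below lam := fun n =>
  ⟨sum_theta_restrict_laplace hN (hf n).1, (hf n).2.laplace hN⟩

theorem leadCoeff_laplace {lam : P 2} {N : ℕ} {f : SymFun} (hN : f ∈ powerSumSubalgebra N)
    (hf : f ∈ below lam) :
    leadCoeff lam (laplace N f) = recCoeff (lam.1 0) (lam.1 1) * leadCoeff lam f :=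
  coeff_restrict_two_laplace_of_exponentsLE hN (hf 2).2 _

/-- The error `g = D f - e f` has no leading term, hence is strictly below `λ`, and so is `D g`.
Then `⟨g, g⟩ = ⟨f, D g⟩ - e ⟨f, g⟩ = 0`, and anisotropy gives `g = 0`. -/
theorem IsJack.laplace_eq {lam : P 2} {f : SymFun} (h : IsJack (toPartition lam) f) :
    ∃ N, f ∈ powerSumSubalgebra N ∧
      laplace N f = recCoeff (lam.1 0) (lam.1 1) • f := by
  obtain ⟨hb, hl, ho⟩ := (isJack_iff lam f).mp h
  obtain ⟨N, hN⟩ := exists_mem_powerSumSubalgebra f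
  set e := recCoeff (lam.1 0) (lam.1 1) with he
  have hmem : laplace N f - e • f ∈ strictlyBelow lam := by
    refine ⟨sub_mem (laplace_mem_below (hN N le_rfl) hb) (Submodule.smul_mem _ _ hb), ?_⟩
    have h1 := leadCoeff_laplace (hN N le_rfl) hb
    rw [leadCoeff, leadCoeff] at h1
    rw [leadCoeff, map_sub, map_smul, coeff_sub, coeff_smul, h1, smul_eq_mul, sub_self]
  refine ⟨N, hN N le_rfl, sub_eq_zero.mp (hall_self_eq_zero ?_)⟩
  set g := laplace N f - e • f
  obtain ⟨N₁, hN₁⟩ := exists_mem_powerSumSubalgebra g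
  have hg := hN₁ (max N N₁) (le_max_right _ _)
  have h2 : laplace (max N N₁) g ∈ strictlyBelow lam := by
    refine ⟨laplace_mem_below hg hmem.1, ?_⟩
    rw [leadCoeff_laplace hg hmem.1, hmem.2, mul_zero]
  have h3 : hall (laplace N f - e • f) g = 0 := by
    rw [← laplace_eq_of_le (le_max_left N N₁) (hN N le_rfl), hall_sub_left, hall_laplace,
      hall_smul_left, ho _ h2, ho _ hmem, mul_zero, sub_zero]
  exact h3

/-! ### Jack polynomials in two variables -/

/-- The polynomial `(x_1 x_2) ^ q ∑_{i + j = m} w_{ij} x_1 ^ i x_2 ^ j`. -/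
def biv (q m : ℕ) (w : ℕ → ℕ → F) : MvPolynomial (Fin 2) F :=
  ∑ x ∈ antidiagonal m, monomial (expPair (q + x.1) (q + x.2)) (w x.1 x.2)

theorem biv_congr {q m : ℕ} {w w' : ℕ → ℕ → F} (h : ∀ i j, i + j = m → w i j = w' i j) :
    biv q m w = biv q m w' :=
  sum_congr rfl fun x hx => by rw [h _ _ (mem_antidiagonal.mp hx)]

theorem biv_sub (q m : ℕ) (w w' : ℕ → ℕ → F) :
    biv q m w - biv q m w' = biv q m fun i j => w i j - w' i j := by
  rw [biv, biv, biv, ← sum_sub_distrib]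
  simp only [map_sub]

theorem biv_add (q m : ℕ) (w w' : ℕ → ℕ → F) :
    biv q m w + biv q m w' = biv q m fun i j => w i j + w' i j := by
  rw [biv, biv, biv, ← sum_add_distrib]
  simp only [map_add]

theorem smul_biv (a : F) (q m : ℕ) (w : ℕ → ℕ → F) :
    a • biv q m w = biv q m fun i j => a * w i j := by
  rw [biv, biv, smul_sum]
  simp only [smul_monomial, smul_eq_mul]

theorem X_mul_expPair_zero (k l : ℕ) (a : F) :
    (X 0 : MvPolynomial (Fin 2) F) * monomial (expPair k l) a = monomial (expPair (k + 1) l) a := by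
  have : expPair (k + 1) l = Finsupp.single 0 1 + expPair k l := by
    ext i; fin_cases i <;> simp [expPair, add_comm]
  rw [X, monomial_mul, one_mul, this]

theorem X_mul_expPair_one (k l : ℕ) (a : F) :
    (X 1 : MvPolynomial (Fin 2) F) * monomial (expPair k l) a = monomial (expPair k (l + 1)) a := by
  have : expPair k (l + 1) = Finsupp.single 1 1 + expPair k l := by
    ext i; fin_cases i <;> simp [expPair, add_comm]
  rw [X, monomial_mul, one_mul, this]

theorem X_zero_mul_biv (q m : ℕ) (w : ℕ → ℕ → F) :
    X 0 * biv q m w = biv q (m + 1) fun i j => if i = 0 then 0 else w (i - 1) j := by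
  rw [biv, biv, Finset.Nat.sum_antidiagonal_succ, mul_sum]
  simp only [X_mul_expPair_zero, if_true, map_zero, zero_add, Nat.add_sub_cancel,
    Nat.add_one_ne_zero, if_false, add_assoc]

theorem X_one_mul_biv (q m : ℕ) (w : ℕ → ℕ → F) :
    X 1 * biv q m w = biv q (m + 1) fun i j => if j = 0 then 0 else w i (j - 1) := by
  rw [biv, biv, Finset.Nat.sum_antidiagonal_succ', mul_sum]
  simp only [X_mul_expPair_one, if_true, map_zero, zero_add, Nat.add_sub_cancel,
    Nat.add_one_ne_zero, if_false, add_assoc]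

theorem biv_succ (q m : ℕ) (w : ℕ → ℕ → F) : biv (q + 1) m w =
    biv q (m + 2) fun i j => if i = 0 ∨ j = 0 then 0 else w (i - 1) (j - 1) := by
  have h : biv (q + 1) m w = X 0 * (X 1 * biv q m w) := by
    rw [biv, biv, mul_sum, mul_sum]
    refine sum_congr rfl fun x _ => ?_
    rw [X_mul_expPair_one, X_mul_expPair_zero, add_right_comm, add_right_comm q 1]
  rw [h, X_one_mul_biv, X_zero_mul_biv]
  refine biv_congr fun i j _ => ?_
  split_ifs <;> simp_all

theorem eq_biv {q m : ℕ} {p : MvPolynomial (Fin 2) F} {w : ℕ → ℕ → F}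
    (h : ∀ i j, i + j = m → p.coeff (expPair (q + i) (q + j)) = w i j)
    (h0 : ∀ M, p.coeff M ≠ 0 → ∃ i j, i + j = m ∧ M = expPair (q + i) (q + j)) :
    p = biv q m w := by
  have hinj : ∀ i j i' j' : ℕ, expPair (q + i) (q + j) = expPair (q + i') (q + j') →
      (i, j) = (i', j') := by
    intro i j i' j' he
    have e0 := DFunLike.congr_fun he 0
    have e1 := DFunLike.congr_fun he 1
    simp only [expPair_zero, expPair_one] at e0 e1
    rw [Prod.mk.injEq]
    omega
  ext M
  rw [biv, coeff_sum]
  simp only [coeff_monomial]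
  by_cases hM : ∃ i j, i + j = m ∧ M = expPair (q + i) (q + j)
  · obtain ⟨i, j, hij, rfl⟩ := hM
    rw [Finset.sum_eq_single (i, j), if_pos rfl, h i j hij]
    · intro x _ hx
      exact if_neg fun he => hx (hinj _ _ _ _ he)
    · intro hx
      exact absurd (mem_antidiagonal.mpr hij) hx
  · rw [sum_eq_zero]
    · by_contra hc
      exact hM (h0 M hc)
    · intro x hx
      exact if_neg fun he => hM ⟨x.1, x.2, mem_antidiagonal.mp hx, he.symm⟩

theorem eval_one_biv (q m : ℕ) (w : ℕ → ℕ → F) :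
    eval (fun _ => (1 : F)) (biv q m w) = ∑ x ∈ antidiagonal m, w x.1 x.2 := by
  rw [biv, map_sum]
  refine sum_congr rfl fun x _ => ?_
  rw [eval_monomial]
  simp

/-- The coefficient `(s)_i / i!` of `t ^ i` in `(1 - t) ^ {-s}`. -/
def risingCoeff (s : F) : ℕ → F
  | 0 => 1
  | i + 1 => risingCoeff s i * (s + i) / (i + 1)

theorem tau_add_natCast_ne_zero (i : ℕ) : tau + i ≠ 0 := by
  obtain ⟨φ, hφ⟩ := exists_real_embedding
  intro h
  have := congrArg φ h
  rw [map_add, map_natCast, map_zero] at this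
  have : (0 : ℝ) ≤ i := Nat.cast_nonneg i
  linarith

theorem risingCoeff_tau_ne_zero (i : ℕ) : risingCoeff tau i ≠ 0 := by
  induction i with
  | zero => exact one_ne_zero
  | succ i ih =>
    exact div_ne_zero (mul_ne_zero ih (tau_add_natCast_ne_zero i)) (Nat.cast_add_one_ne_zero i)

theorem jackFunction_isJack (lam : P 2) :
    IsJack (toPartition lam) (jackFunction (toPartition lam)) := by
  have h := exists_isJack lam
  rw [jackFunction, dif_pos h]
  exact h.choose_spec

theorem coeff_jack_step (lam : P 2) (k l : ℕ) :
    (recCoeff k (l + 1) - recCoeff (lam.1 0) (lam.1 1)) * (jack lam).coeff (expPair k (l + 1)) =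
      (recCoeff l (k + 1) - recCoeff (lam.1 0) (lam.1 1)) *
        (jack lam).coeff (expPair (k + 1) l) := by
  obtain ⟨N, hN, hl⟩ := (jackFunction_isJack lam).laplace_eq
  have h := coeff_restrict_two_laplace hN k l
  rw [hl, map_smul, coeff_smul, coeff_smul, smul_eq_mul, smul_eq_mul] at h
  rw [jack]
  linear_combination -h

/-- The eigenvalue differences factor as `-2 (j+1)(τ+i)` and `-2 (i+1)(τ+j)`, so the recurrence
fixes the ratio of neighbouring coefficients. It starts from the leading coefficient `1`. -/
theorem jack_eq_biv (lam : P 2) : jack lam = biv (lam.1 1) (lam.1 0 - lam.1 1)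
    fun i j => (risingCoeff tau (lam.1 0 - lam.1 1))⁻¹ *
      (risingCoeff tau i * risingCoeff tau j) := by
  have hle := snd_le_fst lam
  obtain ⟨hb, hl, -⟩ := (isJack_iff lam _).mp (jackFunction_isJack lam)
  refine eq_biv ?_ fun M hM => ?_
  · intro i j
    induction j generalizing i with
    | zero =>
      intro hi
      have h1 : (jack lam).coeff (expPair (lam.1 0) (lam.1 1)) = 1 := hl
      rw [← hi, add_zero, add_zero, inv_mul_cancel_left₀ (risingCoeff_tau_ne_zero i),
        show lam.1 1 + i = lam.1 0 by omega, h1]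
      rfl
    | succ j ih =>
      intro hij
      have ih' := ih (i + 1) (by omega)
      have hs := coeff_jack_step lam (lam.1 1 + i) (lam.1 1 + j)
      rw [add_assoc, add_assoc, ih', risingCoeff] at hs
      have h0 : (lam.1 0 : F) = lam.1 1 + (i + 1 + j) := by
        have : lam.1 0 = lam.1 1 + (i + 1 + j) := by omega
        rw [this]
        push_cast
        ring
      have e1 : recCoeff ((lam.1 1 + i : ℕ) : F) ((lam.1 1 + j : ℕ) + 1) -
          recCoeff (lam.1 0) (lam.1 1) = -2 * ((j + 1) * (tau + i)) := by
        rw [recCoeff, recCoeff, h0]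
        push_cast
        ring
      have e2 : recCoeff ((lam.1 1 + j : ℕ) : F) ((lam.1 1 + i : ℕ) + 1) -
          recCoeff (lam.1 0) (lam.1 1) = -2 * ((i + 1) * (tau + j)) := by
        rw [recCoeff, recCoeff, h0]
        push_cast
        ring
      rw [e1, e2] at hs
      have hi1 : (i + 1 : F) ≠ 0 := Nat.cast_add_one_ne_zero i
      have hj1 : (j + 1 : F) ≠ 0 := Nat.cast_add_one_ne_zero j
      have hti := tau_add_natCast_ne_zero i
      rw [risingCoeff]
      have h2 : (-2 * ((j + 1) * (tau + i)) : F) ≠ 0 := by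
        refine mul_ne_zero (by norm_num) (mul_ne_zero hj1 hti)
      refine mul_left_cancel₀ h2 (hs.trans ?_)
      field_simp
  -- The exponents add up to `λ_1 + λ_2` and neither exceeds `λ_1`, so both are at least `λ_2`.
  · have h1 := sum_eq_of_coeff_ne_zero (hb 2).1 hM
    have h2 := (hb 2).2 M (mem_support_iff.mpr hM)
    rw [Fin.sum_univ_two, Fin.sum_univ_two] at h1
    have h20 := h2 0
    have h21 := h2 1
    refine ⟨M 0 - lam.1 1, M 1 - lam.1 1, by omega, ?_⟩
    rw [eq_expPair M]
    simp only [expPair_zero, expPair_one]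
    congr 1 <;> omega

/-- The value at `(1, 1)` of `∑_{i + j = m} ((τ)_i / i!) ((τ)_j / j!) x_1 ^ i x_2 ^ j`. -/
def gegenbauerOne (m : ℕ) : F :=
  ∑ x ∈ antidiagonal m, risingCoeff tau x.1 * risingCoeff tau x.2

/-- The polynomial `(x_1 x_2) ^ q ∑_{i + j = m} ((s)_i / i!) ((s)_j / j!) x_1 ^ i x_2 ^ j`. -/
def gegenbauer (s : F) (q m : ℕ) : MvPolynomial (Fin 2) F :=
  biv q m fun i j => risingCoeff s i * risingCoeff s j

theorem normalized_jack (lam : P 2) : normalized (jack lam) =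
    (gegenbauerOne (lam.1 0 - lam.1 1))⁻¹ • gegenbauer tau (lam.1 1) (lam.1 0 - lam.1 1) := by
  have h : jack lam = (risingCoeff tau (lam.1 0 - lam.1 1))⁻¹ •
      gegenbauer tau (lam.1 1) (lam.1 0 - lam.1 1) := by
    rw [jack_eq_biv, gegenbauer, smul_biv]
  have h0 := risingCoeff_tau_ne_zero (lam.1 0 - lam.1 1)
  rw [normalized, h, smul_eval, gegenbauer, eval_one_biv, ← gegenbauerOne, mul_inv, inv_inv,
    smul_smul, mul_right_comm, mul_inv_cancel₀ h0, one_mul]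

/-- Both equalities are `τ (τ+1)_i = (τ)_{i+1} = (τ)_i (τ+i)`, divided by `i!`. -/
theorem tau_mul_risingCoeff (i : ℕ) : tau * risingCoeff (tau + 1) i =
    (i + 1) * risingCoeff tau (i + 1) ∧
    tau * risingCoeff (tau + 1) i = (tau + i) * risingCoeff tau i := by
  have h2 : ∀ i : ℕ, tau * risingCoeff (tau + 1) i = (tau + i) * risingCoeff tau i := by
    intro i
    induction i with
    | zero => simp [risingCoeff]
    | succ i ih =>
      have hi1 : (i + 1 : F) ≠ 0 := Nat.cast_add_one_ne_zero i
      rw [risingCoeff, risingCoeff, mul_div_assoc', ← mul_assoc, ih]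
      push_cast
      field_simp
      ring
  have hi1 : (i + 1 : F) ≠ 0 := Nat.cast_add_one_ne_zero i
  refine ⟨?_, h2 i⟩
  rw [h2, risingCoeff]
  field_simp

/-- Checked coefficientwise, with everything expressed through `(τ)_i/i!` and `(τ)_j/j!`. The two
extreme monomials are treated apart because `x_1 x_2 G_k^τ` does not contain them. -/
theorem gegenbauer_contiguous (q k : ℕ) :
    ((k + 2) * (k + 1) : F) • gegenbauer tau q (k + 2) -
      ((k + 2 * tau) * (k + 1 + 2 * tau)) • gegenbauer tau (q + 1) k =
    (tau * (k + 1 + tau)) • ((X 0 - X 1) ^ 2 * gegenbauer (tau + 1) q k) := by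
  have h : (X 0 - X 1) ^ 2 * gegenbauer (tau + 1) q k =
      X 0 * (X 0 * gegenbauer (tau + 1) q k) + X 1 * (X 1 * gegenbauer (tau + 1) q k) -
      (2 : F) • (X 0 * (X 1 * gegenbauer (tau + 1) q k)) := by
    rw [two_smul]
    ring
  rw [h]
  simp only [gegenbauer, X_zero_mul_biv, X_one_mul_biv, biv_succ, smul_biv, biv_sub, biv_add]
  refine biv_congr fun i j hij => ?_
  have ht := tau_ne_zero
  have edge : ∀ k : ℕ, ((k + 2) * (k + 1) : F) * risingCoeff tau (k + 2) =
      tau * (k + 1 + tau) * risingCoeff (tau + 1) k := by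
    intro k
    have h1 := (tau_mul_risingCoeff k).1
    have h2 := (tau_mul_risingCoeff (k + 1)).1
    have h3 := (tau_mul_risingCoeff (k + 1)).2
    push_cast at h2 h3
    linear_combination (-k - 1 : F) * h2 + (k + 1 : F) * h3 - (k + 1 + tau : F) * h1
  -- The factor `i` on the right absorbs the boundary case `i = 0`, so the interior needs no further
  -- splitting.
  have lower : ∀ i : ℕ, (if i = 0 then 0 else risingCoeff (tau + 1) (i - 1)) =
      i * risingCoeff tau i / tau := by
    intro i
    rw [eq_div_iff ht]
    split_ifs with h
    · simp [h]
    · obtain ⟨i, rfl⟩ := Nat.exists_eq_succ_of_ne_zero h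
      rw [Nat.succ_eq_add_one, Nat.add_sub_cancel, mul_comm, (tau_mul_risingCoeff i).1]
      push_cast
      ring
  have upper : ∀ i : ℕ, risingCoeff (tau + 1) i = (tau + i) * risingCoeff tau i / tau := by
    intro i
    rw [eq_div_iff ht, mul_comm, (tau_mul_risingCoeff i).2]
  rcases i with _ | i
  · obtain rfl : j = k + 2 := by omega
    simpa [risingCoeff] using edge k
  rcases j with _ | j
  · obtain rfl : i = k + 1 := by omega
    simpa [risingCoeff] using edge k
  have hk : (k : F) = i + j := by
    have : k = i + j := by omega
    rw [this, Nat.cast_add]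
  have hi1 : (i + 1 : F) ≠ 0 := Nat.cast_add_one_ne_zero i
  have hj1 : (j + 1 : F) ≠ 0 := Nat.cast_add_one_ne_zero j
  have e1 : (if i = 0 then 0 else risingCoeff (tau + 1) (i - 1) * risingCoeff (tau + 1) (j + 1)) =
      i * risingCoeff tau i / tau * risingCoeff (tau + 1) (j + 1) := by
    rw [← lower, ite_mul, zero_mul]
  have e2 : (if j = 0 then 0 else risingCoeff (tau + 1) (i + 1) * risingCoeff (tau + 1) (j - 1)) =
      risingCoeff (tau + 1) (i + 1) * (j * risingCoeff tau j / tau) := by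
    rw [← lower, mul_ite, mul_zero]
  simp only [Nat.add_one_ne_zero, or_self, if_false, Nat.add_sub_cancel, e1, e2]
  rw [upper i, upper j, upper (i + 1), upper (j + 1), risingCoeff, risingCoeff, hk]
  push_cast
  field_simp
  ring

/-! ### The cone of positivity -/

theorem algebraMap_map_ne_zero {g : Polynomial ℕ} (hg : g ≠ 0) :
    algebraMap (Polynomial ℚ) F (g.map (Nat.castRingHom ℚ)) ≠ 0 := by
  rw [Ne, FaithfulSMul.algebraMap_eq_zero_iff]
  exact (Polynomial.map_ne_zero_iff (RingHom.injective_nat _)).mpr hg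

theorem mem_posCone_of_polynomial (f : Polynomial ℕ) :
    algebraMap (Polynomial ℚ) F (f.map (Nat.castRingHom ℚ)) ∈ posCone :=
  ⟨f, 1, one_ne_zero, by simp⟩

theorem posCone_add {a b : F} (ha : a ∈ posCone) (hb : b ∈ posCone) : a + b ∈ posCone := by
  obtain ⟨f, g, hg, rfl⟩ := ha
  obtain ⟨f', g', hg', rfl⟩ := hb
  refine ⟨f * g' + g * f', g * g', mul_ne_zero hg hg', ?_⟩
  rw [div_add_div _ _ (algebraMap_map_ne_zero hg) (algebraMap_map_ne_zero hg')]
  simp only [Polynomial.map_add, Polynomial.map_mul, map_add, map_mul]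

theorem posCone_mul {a b : F} (ha : a ∈ posCone) (hb : b ∈ posCone) : a * b ∈ posCone := by
  obtain ⟨f, g, hg, rfl⟩ := ha
  obtain ⟨f', g', hg', rfl⟩ := hb
  refine ⟨f * f', g * g', mul_ne_zero hg hg', ?_⟩
  rw [div_mul_div_comm]
  simp only [Polynomial.map_mul, map_mul]

theorem posCone_inv {a : F} (ha : a ∈ posCone) : a⁻¹ ∈ posCone := by
  obtain ⟨f, g, hg, rfl⟩ := ha
  by_cases hf : f = 0
  -- Here the convention `0⁻¹ = 0` keeps the inverse in the cone.
  · exact ⟨0, 1, one_ne_zero, by simp [hf]⟩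
  · exact ⟨g, f, hf, by rw [inv_div]⟩

theorem posCone_div {a b : F} (ha : a ∈ posCone) (hb : b ∈ posCone) : a / b ∈ posCone := by
  rw [div_eq_mul_inv]
  exact posCone_mul ha (posCone_inv hb)

theorem natCast_mem_posCone (n : ℕ) : (n : F) ∈ posCone := by
  simpa using mem_posCone_of_polynomial (n : Polynomial ℕ)

theorem zero_mem_posCone : (0 : F) ∈ posCone := by
  simpa using natCast_mem_posCone 0

theorem one_mem_posCone : (1 : F) ∈ posCone := by
  simpa using natCast_mem_posCone 1

theorem tau_mem_posCone : tau ∈ posCone := by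
  have h := mem_posCone_of_polynomial Polynomial.X
  rwa [Polynomial.map_X, RatFunc.algebraMap_X] at h

theorem posCone_sum {ι : Type*} {s : Finset ι} {f : ι → F} (h : ∀ i ∈ s, f i ∈ posCone) :
    ∑ i ∈ s, f i ∈ posCone :=
  Finset.sum_induction f (· ∈ posCone) (fun _ _ => posCone_add) zero_mem_posCone h

theorem risingCoeff_mem_posCone {s : F} (hs : s ∈ posCone) (i : ℕ) :
    risingCoeff s i ∈ posCone := by
  induction i with
  | zero => exact one_mem_posCone
  | succ i ih =>
    refine posCone_div (posCone_mul ih (posCone_add hs (natCast_mem_posCone i))) ?_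
    exact posCone_add (natCast_mem_posCone i) one_mem_posCone

theorem gegenbauerOne_mem_posCone (m : ℕ) : gegenbauerOne m ∈ posCone :=
  posCone_sum fun _ _ => posCone_mul (risingCoeff_mem_posCone tau_mem_posCone _)
    (risingCoeff_mem_posCone tau_mem_posCone _)

theorem gegenbauerOne_ne_zero (m : ℕ) : gegenbauerOne m ≠ 0 := by
  obtain ⟨φ, hφ⟩ := exists_real_embedding
  have h : ∀ i, 0 < φ (risingCoeff tau i) := by
    intro i
    induction i with
    | zero => rw [risingCoeff, map_one]; exact one_pos
    | succ i ih =>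
      rw [risingCoeff, map_div₀, map_mul, map_add, map_add, map_natCast, map_one]
      positivity
  intro h0
  have h1 : φ (gegenbauerOne m) = 0 := by rw [h0, map_zero]
  rw [gegenbauerOne, map_sum] at h1
  refine (Finset.sum_pos (fun x _ => ?_) ⟨(0, m), by simp⟩).ne' h1
  rw [map_mul]
  exact mul_pos (h _) (h _)

/-! ### Schur polynomials in two variables -/

/-- The alternant `x_1 ^ {ν_1 + 1} x_2 ^ {ν_2} - x_1 ^ {ν_2} x_2 ^ {ν_1 + 1}`. -/
def alternant (nu : P 2) : MvPolynomial (Fin 2) F :=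
  X 0 ^ (nu.1 0 + 1) * X 1 ^ nu.1 1 - X 0 ^ nu.1 1 * X 1 ^ (nu.1 0 + 1)

theorem X_sub_X_ne_zero : (X 0 - X 1 : MvPolynomial (Fin 2) F) ≠ 0 :=
  sub_ne_zero.mpr fun h => absurd (X_injective h) (by decide)

theorem toRatX_ne_zero {n : ℕ} {p : MvPolynomial (Fin n) F} (h : p ≠ 0) : toRatX p ≠ 0 :=
  (map_ne_zero_iff _ (IsFractionRing.injective _ _)).mpr h

theorem vandermonde_two : vandermonde 2 = X 0 - X 1 := by
  have h0 : Finset.Ioi (0 : Fin 2) = {1} := by decide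
  have h1 : Finset.Ioi (1 : Fin 2) = ∅ := by decide
  rw [vandermonde, Fin.prod_univ_two, h0, h1, prod_singleton, prod_empty, mul_one]

theorem schur_eq_div (nu : P 2) :
    schur nu = toRatX (alternant nu) / toRatX (X 0 - X 1 : MvPolynomial (Fin 2) F) := by
  rw [schur, Matrix.det_fin_two, Matrix.det_fin_two, alternant]
  simp only [Matrix.of_apply, Fin.val_zero, Fin.val_one, Nat.sub_zero, Nat.sub_self, add_zero,
    pow_zero, pow_one, mul_one, one_mul, Nat.add_one_sub_one]

theorem toRatX_eq_schur {nu : P 2} {p : MvPolynomial (Fin 2) F}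
    (h : p * (X 0 - X 1) = alternant nu) : toRatX p = schur nu := by
  rw [schur_eq_div, eq_div_iff (toRatX_ne_zero X_sub_X_ne_zero), ← h]
  exact (map_mul _ _ _).symm

theorem toRatX_smul {n : ℕ} (a : F) (p : MvPolynomial (Fin n) F) :
    toRatX (a • p) = a • toRatX p :=
  (IsScalarTower.toAlgHom F (MvPolynomial (Fin n) F) (RatX n)).toLinearMap.map_smul a p

theorem X_pow_mul_X_pow (k l : ℕ) : (X 0 ^ k * X 1 ^ l : MvPolynomial (Fin 2) F) =
    monomial (expPair k l) 1 := by
  simp only [X_pow_eq_monomial, monomial_mul, one_mul, expPair]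

theorem alternant_eq_monomial (nu : P 2) : alternant nu =
    monomial (expPair (nu.1 0 + 1) (nu.1 1)) 1 - monomial (expPair (nu.1 1) (nu.1 0 + 1)) 1 := by
  rw [alternant, X_pow_mul_X_pow, X_pow_mul_X_pow]

theorem coeff_alternant (nu mu : P 2) :
    (alternant mu).coeff (expPair (nu.1 0 + 1) (nu.1 1)) = if mu = nu then 1 else 0 := by
  have h1 := snd_le_fst nu
  have h2 := snd_le_fst mu
  rw [alternant_eq_monomial, coeff_sub, coeff_monomial, coeff_monomial]
  have hne : expPair (mu.1 1) (mu.1 0 + 1) ≠ expPair (nu.1 0 + 1) (nu.1 1) := by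
    intro h
    have e0 := DFunLike.congr_fun h 0
    have e1 := DFunLike.congr_fun h 1
    simp only [expPair_zero, expPair_one] at e0 e1
    omega
  rw [if_neg hne, sub_zero]
  congr 1
  rw [eq_iff_iff]
  refine ⟨fun h => Subtype.ext (funext fun i => ?_), fun h => by rw [h]⟩
  have e0 := DFunLike.congr_fun h 0
  have e1 := DFunLike.congr_fun h 1
  simp only [expPair_zero, expPair_one] at e0 e1
  fin_cases i
  · exact Nat.succ_injective e0
  · exact e1

/-- After multiplication by `x_1 - x_2` the Schur polynomials become alternants, and the monomial
`x_1^{ν_1+1} x_2^{ν_2}` occurs only in the alternant of `ν`. -/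
theorem linearIndependent_schur : LinearIndependent F (schur : P 2 → RatX 2) := by
  rw [linearIndependent_iff]
  intro c hc
  have h1 : (c.sum fun nu r => r • alternant nu) = 0 := by
    refine (map_eq_zero_iff _ (IsFractionRing.injective (MvPolynomial (Fin 2) F) (RatX 2))).mp ?_
    have h2 : c.sum (fun nu r => r • schur nu) * toRatX (X 0 - X 1) = 0 := by
      have : c.sum (fun nu r => r • schur nu) = 0 := hc
      rw [this, zero_mul]
    rw [Finsupp.sum, sum_mul] at h2
    rw [Finsupp.sum, map_sum, ← h2]
    refine sum_congr rfl fun nu _ => ?_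
    rw [smul_mul_assoc, schur_eq_div, div_mul_cancel₀ _ (toRatX_ne_zero X_sub_X_ne_zero)]
    exact toRatX_smul _ _
  ext nu
  have h3 := congrArg (coeff (expPair (nu.1 0 + 1) (nu.1 1))) h1
  rw [Finsupp.sum, coeff_sum, coeff_zero] at h3
  simp only [coeff_smul, coeff_alternant, smul_eq_mul, mul_ite, mul_one, mul_zero] at h3
  rw [Finset.sum_ite_eq'] at h3
  simpa using h3

/-- Nonnegative combinations of Schur polynomials. -/
def SchurPositive (r : RatX 2) : Prop :=
  ∃ c : P 2 →₀ F, (∀ nu, c nu ∈ posCone) ∧ r = c.sum fun nu a => a • schur nu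

theorem SchurPositive.zero : SchurPositive 0 :=
  ⟨0, fun _ => zero_mem_posCone, by simp⟩

theorem SchurPositive.add {r s : RatX 2} (hr : SchurPositive r) (hs : SchurPositive s) :
    SchurPositive (r + s) := by
  obtain ⟨c, hc, rfl⟩ := hr
  obtain ⟨c', hc', rfl⟩ := hs
  refine ⟨c + c', fun nu => posCone_add (hc nu) (hc' nu), ?_⟩
  rw [Finsupp.sum_add_index' (by simp) (by simp [add_smul])]

theorem SchurPositive.smul {r : RatX 2} (hr : SchurPositive r) {a : F} (ha : a ∈ posCone) :
    SchurPositive (a • r) := by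
  obtain ⟨c, hc, rfl⟩ := hr
  refine ⟨a • c, fun nu => posCone_mul ha (hc nu), ?_⟩
  rw [Finsupp.sum_smul_index' (by simp), Finsupp.smul_sum]
  simp only [smul_smul, smul_eq_mul]

theorem schurPositive_schur (nu : P 2) : SchurPositive (schur nu) := by
  classical
  refine ⟨Finsupp.single nu 1, fun mu => ?_, by simp⟩
  rw [Finsupp.single_apply]
  split_ifs
  exacts [one_mem_posCone, zero_mem_posCone]

theorem biv_one_mul (q m : ℕ) :
    biv q m (fun _ _ => 1) * (X 0 - X 1) = alternant (pair (q + m) q (by omega)) := by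
  have h := (Commute.all (X 0 : MvPolynomial (Fin 2) F) (X 1)).geom_sum₂_mul (m + 1)
  simp only [Nat.add_sub_cancel] at h
  have h1 : biv q m (fun _ _ => 1) = (X 0 * X 1) ^ q *
      ∑ i ∈ range (m + 1), (X 0 : MvPolynomial (Fin 2) F) ^ i * X 1 ^ (m - i) := by
    rw [biv, Finset.Nat.sum_antidiagonal_eq_sum_range_succ_mk, mul_sum]
    refine sum_congr rfl fun i _ => ?_
    rw [X_mul_X_pow_eq, X_pow_mul_X_pow, monomial_mul, one_mul, expPair_add]
  rw [h1, mul_assoc, h, alternant]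
  simp only [pair, Matrix.cons_val_zero, Matrix.cons_val_one]
  ring

/-- A symmetric form whose coefficients increase towards the middle is a positive sum of Schur
polynomials: subtract the outer coefficient times `s_{(q+m,q)}`, whose coefficients are all `1`.
What remains is divisible by `x_1 x_2` and has the same consecutive differences, with `m` smaller by
two. -/
theorem schurPositive_biv (m : ℕ) : ∀ (q : ℕ) (w : ℕ → ℕ → F),
    (∀ i j, i + j = m → w i j = w j i) → w 0 m ∈ posCone →
    (∀ i j, i + 1 + j = m → i + 1 ≤ j → w (i + 1) j - w i (j + 1) ∈ posCone) →
    SchurPositive (toRatX (biv q m w)) := by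
  induction m using Nat.twoStepInduction with
  | zero =>
    intro q w _ h0 _
    have h : biv q 0 w = w 0 0 • biv q 0 fun _ _ => 1 := by
      rw [smul_biv]
      refine biv_congr fun i j hij => ?_
      obtain ⟨rfl, rfl⟩ : i = 0 ∧ j = 0 := by omega
      rw [mul_one]
    rw [h, toRatX_smul, toRatX_eq_schur (biv_one_mul q 0)]
    exact (schurPositive_schur _).smul h0
  | one =>
    intro q w hs h0 _
    have h : biv q 1 w = w 0 1 • biv q 1 fun _ _ => 1 := by
      rw [smul_biv]
      refine biv_congr fun i j hij => ?_
      rw [mul_one]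
      rcases i with _ | i
      · rw [show j = 1 by omega]
      · obtain ⟨rfl, rfl⟩ : i = 0 ∧ j = 0 := by omega
        exact hs 1 0 rfl
    rw [h, toRatX_smul, toRatX_eq_schur (biv_one_mul q 1)]
    exact (schurPositive_schur _).smul h0
  | more m ih _ =>
    intro q w hs h0 hu
    have h : biv q (m + 2) w = w 0 (m + 2) • biv q (m + 2) (fun _ _ => 1) +
        biv (q + 1) m fun i j => w (i + 1) (j + 1) - w 0 (m + 2) := by
      rw [smul_biv, biv_succ, biv_add]
      refine biv_congr fun i j hij => ?_
      rcases i with _ | i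
      · obtain rfl : j = m + 2 := by omega
        simp
      · rcases j with _ | j
        · obtain rfl : i = m + 1 := by omega
          rw [hs _ _ (by omega)]
          simp
        · simp
    rw [h]
    unfold toRatX
    rw [map_add]
    refine SchurPositive.add ?_ (ih _ _ (fun i j hij => ?_) ?_ fun i j hij hle => ?_)
    · have := toRatX_smul (w 0 (m + 2)) (biv q (m + 2) fun _ _ => 1)
      unfold toRatX at this
      rw [this]
      exact (toRatX_eq_schur (biv_one_mul q (m + 2)) ▸ schurPositive_schur _).smul h0
    · rw [hs (i + 1) (j + 1) (by omega)]
    · exact hu 0 (m + 1) (by omega) (by omega)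
    · have := hu (i + 1) (j + 1) (by omega) (by omega)
      simpa using this

/-- The sign comes from `(s+i)(j+1) - (s+j)(i+1) = (s-1)(j-i)`. At `s = τ + 1` the factor `s - 1` is
`τ`; the shift of the parameter is what makes it positive. -/
theorem schurPositive_gegenbauer (q m : ℕ) :
    SchurPositive (toRatX (gegenbauer (tau + 1) q m)) := by
  have hc : ∀ i, risingCoeff (tau + 1) i ∈ posCone := fun i =>
    risingCoeff_mem_posCone (posCone_add tau_mem_posCone one_mem_posCone) i
  refine schurPositive_biv m q _ (fun i j _ => mul_comm _ _) (posCone_mul (hc _) (hc _))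
    fun i j _ hle => ?_
  obtain ⟨t, rfl⟩ : ∃ t, j = i + t := ⟨j - i, by omega⟩
  have hi1 : (i + 1 : F) ≠ 0 := Nat.cast_add_one_ne_zero i
  have hj1 : ((i + t : ℕ) + 1 : F) ≠ 0 := Nat.cast_add_one_ne_zero _
  have h : risingCoeff (tau + 1) (i + 1) * risingCoeff (tau + 1) (i + t) -
      risingCoeff (tau + 1) i * risingCoeff (tau + 1) (i + t + 1) =
      risingCoeff (tau + 1) i * risingCoeff (tau + 1) (i + t) * (tau * t) /
        (((i + 1 : ℕ) : F) * ((i + t + 1 : ℕ) : F)) := by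
    rw [risingCoeff, risingCoeff]
    push_cast at hj1 ⊢
    field_simp
    ring
  rw [h]
  exact posCone_div (posCone_mul (posCone_mul (hc _) (hc _))
    (posCone_mul tau_mem_posCone (natCast_mem_posCone t)))
    (posCone_mul (natCast_mem_posCone _) (natCast_mem_posCone _))

/-- The normalized Jack polynomial of the partition `(q + m, q)`. -/
def normalizedGegenbauer (q m : ℕ) : MvPolynomial (Fin 2) F :=
  (gegenbauerOne m)⁻¹ • gegenbauer tau q m

theorem normalizedGegenbauer_sub (q k : ℕ) :
    normalizedGegenbauer q (k + 2) - normalizedGegenbauer (q + 1) k =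
      (tau * (k + 1 + tau) / ((k + 2) * (k + 1) * gegenbauerOne (k + 2))) •
        ((X 0 - X 1) ^ 2 * gegenbauer (tau + 1) q k) := by
  have h := gegenbauer_contiguous q k
  -- At `(1,1)` the factor `(x_1-x_2)^2` vanishes, which yields the ratio of the two normalizing
  -- constants without evaluating either.
  have h1 := congrArg (eval fun _ => (1 : F)) h
  simp only [map_sub, smul_eval, map_mul, map_pow, eval_X, sub_self] at h1
  rw [gegenbauer, gegenbauer, eval_one_biv, eval_one_biv, ← gegenbauerOne, ← gegenbauerOne] at h1
  have hk1 : (k + 1 : F) ≠ 0 := Nat.cast_add_one_ne_zero k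
  have hk2 : (k + 2 : F) ≠ 0 := by exact_mod_cast (Nat.succ_ne_zero (k + 1))
  have hg := gegenbauerOne_ne_zero k
  have hg2 := gegenbauerOne_ne_zero (k + 2)
  have h2 : ((k + 2 * tau) * (k + 1 + 2 * tau)) =
      (k + 2) * (k + 1) * gegenbauerOne (k + 2) / gegenbauerOne k := by
    rw [eq_div_iff hg]
    linear_combination -h1
  rw [div_eq_inv_mul, mul_smul, ← h, smul_sub, smul_smul, smul_smul, h2, normalizedGegenbauer,
    normalizedGegenbauer]
  congr 2
  · field_simp
  · field_simp

/-- Telescoping along the chain `(q+m, q)`, `(q+m-1, q+1)`, and so on: partitions of one number with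
at most two parts are totally ordered by dominance. -/
theorem schurPositive_normalizedGegenbauer_sub (t : ℕ) : ∀ q n : ℕ,
    SchurPositive (toRatX (normalizedGegenbauer q (n + 2 * t) - normalizedGegenbauer (q + t) n) /
      toRatX (vandermonde 2) ^ 2) := by
  induction t with
  | zero =>
    intro q n
    simpa using SchurPositive.zero
  | succ t ih =>
    intro q n
    have h : normalizedGegenbauer q (n + 2 * (t + 1)) - normalizedGegenbauer (q + (t + 1)) n =
        (normalizedGegenbauer q (n + 2 * t + 2) - normalizedGegenbauer (q + 1) (n + 2 * t)) +
        (normalizedGegenbauer (q + 1) (n + 2 * t) - normalizedGegenbauer (q + 1 + t) n) := by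
      rw [show q + 1 + t = q + (t + 1) by omega, show n + 2 * (t + 1) = n + 2 * t + 2 by omega]
      ring
    have hadd : ∀ a b : MvPolynomial (Fin 2) F, toRatX (a + b) = toRatX a + toRatX b :=
      fun a b => map_add _ a b
    have hmul : ∀ a b : MvPolynomial (Fin 2) F, toRatX (a * b) = toRatX a * toRatX b :=
      fun a b => map_mul _ a b
    rw [h, hadd, add_div]
    refine SchurPositive.add ?_ (ih _ _)
    have hv : toRatX (vandermonde 2) ≠ 0 := by
      rw [vandermonde_two]
      exact toRatX_ne_zero X_sub_X_ne_zero
    rw [normalizedGegenbauer_sub, ← vandermonde_two, toRatX_smul, sq, hmul, hmul, sq,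
      smul_div_assoc, mul_div_cancel_left₀ _ (mul_ne_zero hv hv)]
    refine (schurPositive_gegenbauer _ _).smul (posCone_div (posCone_mul tau_mem_posCone ?_)
      (posCone_mul ?_ (gegenbauerOne_mem_posCone _)))
    · exact posCone_add (posCone_add (natCast_mem_posCone _) one_mem_posCone) tau_mem_posCone
    · have := natCast_mem_posCone ((n + 2 * t + 2) * (n + 2 * t + 1))
      push_cast at this ⊢
      exact this

/-! ### Monomial symmetric polynomials in two variables -/

theorem map_eq_of_shape_eq {n : ℕ} {u v : Fin n →₀ ℕ} (h : shape u = shape v) :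
    univ.val.map u = univ.val.map v := by
  have hid : (Fin.castLE (le_refl n)) = id := rfl
  have hu := map_castLE_extend le_rfl u
  have hv := map_castLE_extend le_rfl v
  rw [hid, Finsupp.mapDomain_id] at hu hv
  rw [hu, hv, h]

theorem normalized_monomialSym (lam : P 2) : normalized (monomialSym lam) =
    (1 / 2 : F) • (X 0 ^ lam.1 0 * X 1 ^ lam.1 1 + X 0 ^ lam.1 1 * X 1 ^ lam.1 0) := by
  have hsh : ∀ m : Fin 2 →₀ ℕ, shape m = (toPartition lam).parts ↔
      m = expPair (lam.1 0) (lam.1 1) ∨ m = expPair (lam.1 1) (lam.1 0) := by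
    intro m
    rw [← shape_expPair]
    constructor
    · intro h
      obtain ⟨σ, hσ⟩ := exists_perm_of_map_eq (map_eq_of_shape_eq h)
      have h0 := hσ 0
      have h1 := hσ 1
      simp only [expPair_zero, expPair_one] at h0 h1
      have hs : (σ 0 = 0 ∧ σ 1 = 1) ∨ (σ 0 = 1 ∧ σ 1 = 0) := by
        have : σ 0 ≠ σ 1 := σ.injective.ne (by decide)
        generalize σ 0 = x, σ 1 = y at this
        revert x y
        decide
      rcases hs with ⟨hs0, hs1⟩ | ⟨hs0, hs1⟩
      · left
        rw [eq_expPair m, ← h0, ← h1, hs0, hs1]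
      · right
        rw [eq_expPair m, ← h0, ← h1, hs0, hs1]
    · rintro (rfl | rfl)
      · rfl
      · rw [shape, shape, Fin.univ_val_map, Fin.univ_val_map]
        congr 1
        rw [Multiset.coe_eq_coe]
        simp only [List.ofFn_succ, List.ofFn_zero, expPair_zero,
          show Fin.succ (0 : Fin 1) = (1 : Fin 2) from rfl, expPair_one]
        exact List.Perm.swap _ _ _
  have hev : ∀ k l : ℕ, eval (fun _ => (1 : F)) (monomial (expPair k l) 1) = 1 := by
    intro k l
    rw [eval_monomial]
    simp
  rw [X_pow_mul_X_pow, X_pow_mul_X_pow]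
  -- If the parts are equal, `m_λ` is a single monomial of value `1` at `(1,1)`; otherwise it is a
  -- sum of two, of value `2`. The normalized formula is the same.
  rcases eq_or_ne (lam.1 0) (lam.1 1) with he | he
  · have hm : monomialSym lam = monomial (expPair (lam.1 0) (lam.1 1)) 1 := by
      ext m
      rw [monomialSym, coeff_msymm, coeff_monomial]
      simp only [hsh, he, or_self, eq_comm]
    rw [normalized, hm, hev, he, ← two_smul F (monomial _ _ : MvPolynomial (Fin 2) F), smul_smul]
    norm_num
  · have hm : monomialSym lam = monomial (expPair (lam.1 0) (lam.1 1)) 1 +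
        monomial (expPair (lam.1 1) (lam.1 0)) 1 := by
      have hne : expPair (lam.1 0) (lam.1 1) ≠ expPair (lam.1 1) (lam.1 0) := fun h =>
        he (by simpa using DFunLike.congr_fun h 0)
      ext m
      rw [monomialSym, coeff_msymm, coeff_add, coeff_monomial, coeff_monomial]
      simp only [hsh]
      by_cases h1 : m = expPair (lam.1 0) (lam.1 1)
      · rw [if_pos (Or.inl h1), if_pos h1.symm, if_neg (h1 ▸ hne.symm), add_zero]
      · by_cases h2 : m = expPair (lam.1 1) (lam.1 0)
        · rw [if_pos (Or.inr h2), if_neg (Ne.symm h1), if_pos h2.symm, zero_add]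
        · rw [if_neg (by tauto), if_neg (Ne.symm h1), if_neg (Ne.symm h2), add_zero]
    rw [normalized, hm, map_add, hev, hev, one_div]
    norm_num

theorem add_self_normalized_monomialSym_sub (a b : ℕ) :
    (normalized (monomialSym (pair (a + (b + 1) + 1) a (by omega))) -
        normalized (monomialSym (pair (a + (b + 1)) (a + 1) (by omega)))) +
      (normalized (monomialSym (pair (a + (b + 1) + 1) a (by omega))) -
        normalized (monomialSym (pair (a + (b + 1)) (a + 1) (by omega)))) =
      alternant (pair (a + (b + 1) - 1) a (by omega)) * vandermonde 2 := by
  have h3 : (2 * C (1 / 2) : MvPolynomial (Fin 2) F) = 1 := by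
    rw [show (2 : MvPolynomial (Fin 2) F) = C 2 from (map_ofNat C 2).symm, ← C_mul]
    simp
  rw [normalized_monomialSym, normalized_monomialSym, alternant, vandermonde_two]
  simp only [pair, Matrix.cons_val_zero, Matrix.cons_val_one, smul_eq_C_mul, ← mul_sub]
  rw [← two_mul, ← mul_assoc, h3, one_mul, show a + (b + 1) - 1 = a + b by omega]
  ring

end JackPoly

end

/-! ### The Schur expansions of the normalized differences -/

theorem mainTheorem8 :
    (∀ lam mu : JackPoly.P 2, Majorizes lam.1 mu.1 →
      ∃! c : JackPoly.P 2 →₀ JackPoly.F, (∀ nu, c nu ∈ posCone) ∧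
        toRatX (normalized (jack lam) - normalized (jack mu)) / toRatX (vandermonde 2) ^ 2 =
          c.sum fun nu r => r • schur nu) ∧
    (∀ (a b : ℕ) (hb : 1 ≤ b),
      2 * toRatX (normalized (monomialSym (pair (a + b + 1) a (by omega))) -
          normalized (monomialSym (pair (a + b) (a + 1) (by omega)))) /
          toRatX (vandermonde 2) ^ 2 =
        schur (pair (a + b - 1) a (by omega))) := by
  constructor
  · intro lam mu h
    have hlam := snd_le_fst lam
    have hmu := snd_le_fst mu
    obtain ⟨t, n, h1, h2, h3⟩ : ∃ t n, lam.1 0 - lam.1 1 = n + 2 * t ∧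
        mu.1 1 = lam.1 1 + t ∧ mu.1 0 - mu.1 1 = n := by
      have hs := h.2
      have h0 := h.1 0
      have e : Finset.Iic (0 : Fin 2) = {0} := by decide
      rw [e, sum_singleton, sum_singleton] at h0
      rw [Fin.sum_univ_two, Fin.sum_univ_two] at hs
      -- The number `t = μ_2 - λ_2` counts the unit moves from the first part to the second that
      -- lead from `λ` to `μ`.
      exact ⟨mu.1 1 - lam.1 1, mu.1 0 - mu.1 1, by omega, by omega, rfl⟩
    have hpos := schurPositive_normalizedGegenbauer_sub t (lam.1 1) n
    rw [normalizedGegenbauer, normalizedGegenbauer, ← h1, ← h2, ← h3, ← normalized_jack,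
      ← normalized_jack] at hpos
    obtain ⟨c, hc, hsum⟩ := hpos
    refine ⟨c, ⟨hc, hsum⟩, fun c' hc' => ?_⟩
    exact linearIndependent_schur (hc'.2.symm.trans hsum)
  · intro a b hb
    obtain ⟨b, rfl⟩ : ∃ b', b = b' + 1 := ⟨b - 1, by omega⟩
    have hv : toRatX (vandermonde 2) ≠ 0 := by
      rw [vandermonde_two]
      exact toRatX_ne_zero X_sub_X_ne_zero
    rw [schur_eq_div, ← vandermonde_two, div_eq_div_iff (pow_ne_zero 2 hv) hv, sq, ← mul_assoc,
      two_mul]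
    congr 1
    exact ((map_add _ _ _).symm.trans (congrArg toRatX
      (add_self_normalized_monomialSym_sub a b))).trans (map_mul _ _ _)
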